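/- **Theorem 3 (label supercluster).** Let $p=\{p_j\}_{j=1}^\infty$ be a probability distribution on $\mathbb N=\{1,2,\dots\}$ with $p_j>0$ for all $j$ and $p_1\ge p_2\ge\cdots$. Let $n_1,n_2,\dots$ be independent samples from $p$, and let $\Pi$ be the random permutation of $\mathbb N$ with $\Pi_1=n_1$ and $\Pi_k=\psi_k(n_k)$ for $k\ge2$, where $\psi_k$ is the increasing bijection from $\mathbb N$ onto $\mathbb N\setminus\{\Pi_1,\dots,\Pi_{k-1}\}$ (this $\Pi$ is almost surely a permutation of $\mathbb N$, called the $p$-shifted random permutation). Let $P_n$, the $p$-shifted distribution on the set $S_n$ of permutations of $\{1,\dots,n\}$, be the law of the permutation obtained from $\Pi_1\Pi_2\cdots$ by deleting all entries larger than $n$. Let $A^{(n)}_{l;k}\subset S_n$ be the event that $\{k,k+1,\dots,k+l-1\}\subset\{1,\dots,n\}$ and that these $l$ numbers appear in $l$ consecutive positions of the permutation (empty if $k+l-1>n$). Then for every $k\in\mathbb N$, the limit $\lim_{n\to\infty}P_n(A^{(n)}_{l;k})$ exists for every $l$, and $$\lim_{l\to\infty}\lim_{n\to\infty}P_n(A^{(n)}_{l;k})=\Big(\prod_{j=1}^{k-1}\sum_{i=1}^jp_i\Big)\Big(\prod_{j=1}^\infty\sum_{i=1}^jp_i\Big).$$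 Also, if $\{k_n\}$ is a sequence of positive integers with $\lim_{n\to\infty}\min(k_n,n-k_n)=\infty$, then $$\lim_{l\to\infty}\liminf_{n\to\infty}P_n(A^{(n)}_{l;k_n})=\lim_{l\to\infty}\limsup_{n\to\infty}P_n(A^{(n)}_{l;k_n})=\Big(\prod_{j=1}^\infty\sum_{i=1}^jp_i\Big)^2.$$ Each of these limits is positive if and only if $\sum_{n=1}^\infty np_n<\infty$, or equivalently, if and only if the $p$-shifted random permutation is positive recurrent, that is, $E\,T_1<\infty$, where $T_1$ is the least $m\ge1$ with $\Pi(\{1,\dots,m\})=\{1,\dots,m\}$ ($T_1=\infty$ if there is no such $m$). -/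

import Mathlib

open MeasureTheory Filter Topology
open scoped ENNReal

/-! Conventions. The positive integer `j` is encoded by the natural number `j - 1`, both as a position
and as a value of a permutation and as a value of the distribution `p`. So `p : PMF ℕ` is the
distribution `(p_j)_{j ≥ 1}` with `p_j = p (j - 1)`; permutations of `{1, 2, …}` are `Equiv.Perm ℕ`
(the one-line notation is `σ 0, σ 1, …`), and permutations of `{1, …, n}` are `Equiv.Perm (Fin n)`. -/

namespace PShift

/-- The sequence `Π` built from the samples `s`: the entry at position `k` is `ψ_k (s k)`, where `ψ_k`
is the increasing enumeration of the numbers different from all earlier entries. -/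
noncomputable def shiftSeq (s : ℕ → ℕ) (k : ℕ) : ℕ :=
  Nat.nth (fun m => ∀ j : Fin k, m ≠ shiftSeq s j) (s k)
termination_by k
decreasing_by exact j.2

open Classical in
/-- The permutation of the positive integers built from the samples `s`. (The sequence `shiftSeq s` is
always injective, and it is almost surely onto if the first weight of `p` is positive; on the null
set where it is not onto, the value is irrelevant and set to the identity.) -/
noncomputable def shiftPerm (s : ℕ → ℕ) : Equiv.Perm ℕ :=
  if h : Function.Bijective (shiftSeq s) then Equiv.ofBijective (shiftSeq s) h else 1

/-- The sigma-algebra on permutations of the positive integers generated by the coordinates. -/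
instance permNatMeasurableSpace : MeasurableSpace (Equiv.Perm ℕ) :=
  MeasurableSpace.comap (fun σ : Equiv.Perm ℕ => (σ : ℕ → ℕ)) inferInstance

/-- The discrete sigma-algebra on permutations of `{1, …, n}`. -/
instance permFinMeasurableSpace (n : ℕ) : MeasurableSpace (Equiv.Perm (Fin n)) := ⊤

/-- The `p`-shifted distribution on permutations of the positive integers: the law of the permutation
built from independent samples with distribution `p`. -/
noncomputable def pShifted (p : PMF ℕ) : Measure (Equiv.Perm ℕ) :=
  (Measure.infinitePi (fun _ : ℕ => p.toMeasure)).map shiftPerm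

/-- `proj_n σ`: delete from the one-line notation of `σ` all values that exceed `n`. What is left lists
the `n` smallest values in increasing order of their positions `σ⁻¹ v`; `Tuple.sort f` is the
permutation `τ` of `Fin n` for which `f (τ 0), f (τ 1), …` is increasing. -/
def proj (n : ℕ) (σ : Equiv.Perm ℕ) : Equiv.Perm (Fin n) :=
  Tuple.sort (fun v : Fin n => σ.symm (v : ℕ))

/-- The `p`-shifted distribution `P_n` on permutations of `{1, …, n}`. -/
noncomputable def pShiftedFin (p : PMF ℕ) (n : ℕ) : Measure (Equiv.Perm (Fin n)) :=
  (pShifted p).map (proj n)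

/-- The event `A_{l;k}` in the permutations of `{1, …, n}`: the `l` numbers `k, k + 1, …, k + l - 1`
all belong to `{1, …, n}` and they are the entries in `l` consecutive positions
`m + 1, …, m + l` of `{1, …, n}`. (Position `i : Fin n` is the position `i + 1`, and the entry there
is the number `σ i + 1`.) -/
def cluster (n l k : ℕ) : Set (Equiv.Perm (Fin n)) :=
  {σ | 1 ≤ k ∧ k + l ≤ n + 1 ∧ ∃ m : ℕ, m + l ≤ n ∧
    ∀ i : Fin n, (m + 1 ≤ (i : ℕ) + 1 ∧ (i : ℕ) + 1 ≤ m + l) ↔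
      (k ≤ (σ i : ℕ) + 1 ∧ (σ i : ℕ) + 1 < k + l)}

/-- The partial sum `p_1 + ⋯ + p_j`. -/
noncomputable def partialSum (p : PMF ℕ) (j : ℕ) : ℝ :=
  ∑ i ∈ Finset.range j, (p i).toReal

/-- The first renewal number `T_1`, the least `m ≥ 1` such that `σ` maps `{1, …, m}` onto itself
(infinite if there is none). -/
noncomputable def firstRenewal (σ : Equiv.Perm ℕ) : ℝ≥0∞ :=
  ⨅ (m : ℕ) (_ : 1 ≤ m ∧ σ '' Set.Iio m = Set.Iio m), (m : ℝ≥0∞)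

/-- The `p`-shifted random permutation is positive recurrent: `T_1` has finite expectation. -/
def PositiveRecurrent (p : PMF ℕ) : Prop :=
  ∫⁻ σ, firstRenewal σ ∂(pShifted p) < ∞

/-! The maps whose image measures are taken above are measurable. -/

theorem measurable_shiftSeq (k : ℕ) : Measurable (fun s : ℕ → ℕ => shiftSeq s k) := by
  induction k using Nat.strong_induction_on with
  | _ k ih =>
    have h1 : Measurable (fun s : ℕ → ℕ => (s k, fun j : Fin k => shiftSeq s j)) :=
      (measurable_pi_apply k).prodMk (measurable_pi_lambda _ fun j => ih j j.2)
    have h2 : Measurable (fun x : ℕ × (Fin k → ℕ) => Nat.nth (fun m => ∀ j, m ≠ x.2 j) x.1) :=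
      measurable_of_countable _
    have h3 := h2.comp h1
    convert h3 using 2 with s
    rw [shiftSeq]
    rfl

theorem measurable_shiftPerm : Measurable shiftPerm := by
  have hs : ∀ a b : ℕ, MeasurableSet {s : ℕ → ℕ | shiftSeq s a = b} := fun a b =>
    measurable_shiftSeq a (measurableSet_singleton b)
  have hb : MeasurableSet {s : ℕ → ℕ | Function.Bijective (shiftSeq s)} := by
    have hi : MeasurableSet {s : ℕ → ℕ | ∀ a b : ℕ, shiftSeq s a = shiftSeq s b → a = b} := by
      simp only [Set.ofPred_forall]
      refine MeasurableSet.iInter fun a => MeasurableSet.iInter fun b => ?_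
      by_cases hab : a = b
      · simp [hab]
      · simp only [hab, imp_false]
        exact (measurableSet_eq_fun (measurable_shiftSeq a) (measurable_shiftSeq b)).compl
    have hj : MeasurableSet {s : ℕ → ℕ | ∀ b : ℕ, ∃ a, shiftSeq s a = b} := by
      simp only [Set.ofPred_forall, Set.ofPred_exists]
      exact MeasurableSet.iInter fun b => MeasurableSet.iUnion fun a => hs a b
    exact hi.inter hj
  rw [measurable_comap_iff]
  refine measurable_pi_lambda _ fun a => ?_
  classical
  have : (fun s => ((fun σ : Equiv.Perm ℕ => (σ : ℕ → ℕ)) ∘ shiftPerm) s a) =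
      fun s => if Function.Bijective (shiftSeq s) then shiftSeq s a else a := by
    funext s
    by_cases h : Function.Bijective (shiftSeq s) <;> simp [shiftPerm, h]
  rw [this]
  exact Measurable.ite hb (measurable_shiftSeq a) measurable_const

theorem measurable_proj (n : ℕ) : Measurable (proj n) := by
  have h1 : Measurable (fun σ : Equiv.Perm ℕ => fun v : Fin n => σ.symm (v : ℕ)) := by
    refine measurable_pi_lambda _ fun v => measurable_to_countable' fun m => ?_
    have : (fun σ : Equiv.Perm ℕ => σ.symm (v : ℕ)) ⁻¹' {m} =
        {σ : Equiv.Perm ℕ | (σ : ℕ → ℕ) m = v} := by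
      ext σ
      exact (Equiv.symm_apply_eq σ).trans eq_comm
    rw [this]
    exact ((measurable_pi_apply m).comp (comap_measurable _)) (measurableSet_singleton _)
  have h2 : Measurable (fun f : Fin n → ℕ => Tuple.sort f) := measurable_of_countable _
  exact h2.comp h1

end PShift

open PShift

/-! Deleting the first entry of the shifted sequence and relabelling gives a shifted sequence built
from the remaining samples. Write `N_j` for the partial sums, and consider a block of `l + 1` values
with `a` smaller and `b` larger ones. The first sample removes a smaller value, removes a larger
one, starts the block, or falls beyond all of them and changes nothing. This gives a recursion in
`(a, b)` for the contiguity probability (`contiguousProb_succ`). Its source term is the probability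
that the rest of a started block comes before all other values, which is an explicit product
(`leadingProb_eq`).

If a smaller value is still missing when the block starts, the block survives with probability at
most `(1 - N_1)^l`, which is negligible for large `l`. So essentially all `a` smaller values must
come first, with probability `ratioProd p l a`, and then the block must precede the remaining larger
values, with probability close to `N_1 ⋯ N_l` when many of these remain. The lower bound is
`ratioProd_mul_le_contiguousProb`. The upper bound `contiguousProb_le` adds a Markov estimate for
the number of larger values used up early. As `l → ∞`, `ratioProd p l a` tends to `N_1 ⋯ N_a`; as `a
→ ∞`, it tends to `N_1 ⋯ N_{l+1}`. These give the two limits.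

The infinite product is positive exactly if the tails `1 - N_j` are summable, that is, if the mean
is finite. A renewal occurs at `m` with probability `N_1 ⋯ N_m`. Decomposing by the last renewal up
to `n` links the limit of these probabilities to the sum of `P(T_1 > j)`, which is `E T_1`
(`positiveRecurrent_iff_tprod_pos`). -/

namespace PShift

/-! ### The shifted sequence after removal of its first entry -/

/-- The increasing enumeration of the natural numbers different from `j`. -/
def skip (j m : ℕ) : ℕ := if m < j then m else m + 1

lemma skip_strictMono (j : ℕ) : StrictMono (skip j) := by
  intro a b h
  unfold skip
  split_ifs <;> omega

lemma skip_ne (j m : ℕ) : skip j m ≠ j := by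
  unfold skip
  split_ifs <;> omega

lemma exists_skip_eq {j m : ℕ} (h : m ≠ j) : ∃ i, skip j i = m := by
  rcases lt_or_gt_of_ne h with h | h
  · exact ⟨m, by simp [skip, h]⟩
  · refine ⟨m - 1, ?_⟩
    unfold skip
    split_ifs <;> omega

lemma shiftSeq_zero (s : ℕ → ℕ) : shiftSeq s 0 = s 0 := by
  rw [shiftSeq]
  simp

lemma infinite_setOf_forall_ne {k : ℕ} (f : Fin k → ℕ) :
    (Set.ofPred fun m => ∀ j : Fin k, m ≠ f j).Infinite := by
  have h : (Set.ofPred fun m => ∀ j : Fin k, m ≠ f j) = (Set.range f)ᶜ := by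
    ext m
    simp [eq_comm]
  rw [h]
  exact (Set.finite_range f).infinite_compl

/-- The source of every recursion below. The numbers still available after the first choice are the
image of `skip (s 0)`, so the later choices are those of a fresh shifted sequence, relabelled
increasingly. -/
lemma shiftSeq_succ (s : ℕ → ℕ) (k : ℕ) :
    shiftSeq s (k + 1) = skip (s 0) (shiftSeq (fun i => s (i + 1)) k) := by
  induction k using Nat.strong_induction_on with
  | _ k ih =>
    rw [shiftSeq, shiftSeq]
    have h := Nat.nth_comp_of_strictMono (n := s (k + 1))
      (p := fun m => ∀ j : Fin (k + 1), m ≠ shiftSeq s j) (skip_strictMono (s 0))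
      (fun m hm => exists_skip_eq (by simpa [shiftSeq_zero] using hm 0))
      (fun hfin => absurd hfin (infinite_setOf_forall_ne _))
    rw [← h]
    congr 2
    funext m
    refine propext ⟨fun hm j hj => ?_, fun hm j => ?_⟩
    · have := hm j.succ
      rw [Fin.val_succ, ih j j.2, ← hj] at this
      exact this rfl
    · refine Fin.cases ?_ (fun j => ?_) j
      · simpa [shiftSeq_zero] using skip_ne (s 0) m
      · rw [Fin.val_succ, ih j j.2]
        exact fun hj => hm j ((skip_strictMono (s 0)).injective hj)

lemma shiftSeq_ne_of_lt (s : ℕ → ℕ) {i k : ℕ} (h : i < k) : shiftSeq s k ≠ shiftSeq s i := by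
  rw [shiftSeq.eq_1 s k]
  exact Nat.nth_mem_of_infinite (infinite_setOf_forall_ne fun j : Fin k => shiftSeq s j) (s k) ⟨i, h⟩

lemma shiftSeq_injective (s : ℕ → ℕ) : Function.Injective (shiftSeq s) := by
  intro a b hab
  rcases lt_trichotomy a b with h | h | h
  · exact absurd hab.symm (shiftSeq_ne_of_lt s h)
  · exact h
  · exact absurd hab (shiftSeq_ne_of_lt s h)

/-- If the smallest available number is taken infinitely often, all numbers are eventually taken. -/
lemma shiftSeq_surjective {s : ℕ → ℕ} (hs : ∀ K, ∃ k, K ≤ k ∧ s k = 0) :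
    Function.Surjective (shiftSeq s) := by
  intro v
  induction v generalizing s with
  | zero =>
    have key : ∀ k (t : ℕ → ℕ), t k = 0 → ∃ i, shiftSeq t i = 0 := by
      intro k
      induction k with
      | zero => exact fun t ht => ⟨0, by rw [shiftSeq_zero, ht]⟩
      | succ k ih =>
        intro t ht
        rcases Nat.eq_zero_or_pos (t 0) with h0 | h0
        · exact ⟨0, by rw [shiftSeq_zero, h0]⟩
        · obtain ⟨i, hi⟩ := ih (fun i => t (i + 1)) ht
          exact ⟨i + 1, by rw [shiftSeq_succ, hi]; simp [skip, h0]⟩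
    obtain ⟨k, -, hk⟩ := hs 0
    exact key k s hk
  | succ v ih =>
    have key : ∀ k (t : ℕ → ℕ), (∀ K, ∃ k, K ≤ k ∧ t k = 0) → t k = 0 →
        ∃ i, shiftSeq t i = v + 1 := by
      intro k
      induction k with
      | zero =>
        intro t ht h0
        obtain ⟨i, hi⟩ := ih (s := fun i => t (i + 1)) (fun K => by
          obtain ⟨k, hk, hk0⟩ := ht (K + 1)
          exact ⟨k - 1, by omega, by simpa [Nat.sub_add_cancel (by omega : 1 ≤ k)] using hk0⟩)
        exact ⟨i + 1, by rw [shiftSeq_succ, hi, h0]; simp [skip]⟩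
      | succ k ihk =>
        intro t ht hk0
        have ht' : ∀ K, ∃ k, K ≤ k ∧ t (k + 1) = 0 := fun K => by
          obtain ⟨k, hk, hk0⟩ := ht (K + 1)
          exact ⟨k - 1, by omega, by rwa [Nat.sub_add_cancel (by omega : 1 ≤ k)]⟩
        -- A smaller first entry lowers the sought value to `v`, where the outer induction applies.
        -- A larger one leaves it at `v + 1`, but the zero sample is then one step nearer.
        rcases lt_trichotomy (t 0) (v + 1) with h | h | h
        · obtain ⟨i, hi⟩ := ih ht'
          refine ⟨i + 1, ?_⟩
          rw [shiftSeq_succ, hi, skip, if_neg (by omega)]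
        · exact ⟨0, by rw [shiftSeq_zero, h]⟩
        · obtain ⟨i, hi⟩ := ihk _ ht' hk0
          refine ⟨i + 1, ?_⟩
          rw [shiftSeq_succ, hi, skip, if_pos h]
    obtain ⟨k, -, hk⟩ := hs 0
    exact key k s hs hk

/-- The sequence with first entry `j`, followed by `s`. -/
def cons (j : ℕ) (s : ℕ → ℕ) : ℕ → ℕ
  | 0 => j
  | k + 1 => s k

lemma shiftSeq_cons_zero (j : ℕ) (s : ℕ → ℕ) : shiftSeq (cons j s) 0 = j := shiftSeq_zero _

lemma shiftSeq_cons_succ (j : ℕ) (s : ℕ → ℕ) (k : ℕ) :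
    shiftSeq (cons j s) (k + 1) = skip j (shiftSeq s k) := shiftSeq_succ _ k

/-! ### Effect of the first sample on blocks and renewals -/

/-- Once a value in `{a, …, a + l - 1}` has occurred, all values less than `a + l + b` that occur up to
the last such value are in `{a, …, a + l - 1}`. -/
def Contiguous (a l b : ℕ) (x : ℕ → ℕ) : Prop :=
  ∀ i j k, i < j → j < k → a ≤ x i → x i < a + l → a ≤ x k → x k < a + l → x j < a + l + b →
    a ≤ x j ∧ x j < a + l

/-- Among the values less than `a + l + b`, those in `{a, …, a + l - 1}` come first. -/
def Leading (a l b : ℕ) (x : ℕ → ℕ) : Prop :=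
  ∀ j k, j < k → a ≤ x k → x k < a + l → x j < a + l + b → a ≤ x j ∧ x j < a + l

/-- The first `m` entries are less than `m`. -/
def RenewalAt (m : ℕ) (x : ℕ → ℕ) : Prop := ∀ k, k < m → x k < m

section recursion

variable {j a l b : ℕ} {s : ℕ → ℕ}

lemma contiguous_cons_of_lt (hj : j < a + 1) :
    Contiguous (a + 1) l b (shiftSeq (cons j s)) ↔ Contiguous a l b (shiftSeq s) := by
  constructor
  · intro h i q k hiq hqk h1 h2 h3 h4 h5
    have := h (i + 1) (q + 1) (k + 1) (by omega) (by omega)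
    simp only [shiftSeq_cons_succ, skip] at this
    split_ifs at this <;> omega
  · intro h i q k hiq hqk h1 h2 h3 h4 h5
    obtain ⟨q, rfl⟩ := Nat.exists_eq_add_of_lt (Nat.zero_lt_of_lt hiq)
    obtain ⟨k, rfl⟩ := Nat.exists_eq_add_of_lt (Nat.zero_lt_of_lt hqk)
    rcases i with _ | i
    · rw [shiftSeq_cons_zero] at h1
      omega
    have := h i q k (by omega) (by omega)
    simp only [zero_add, shiftSeq_cons_succ, skip] at *
    split_ifs at * <;> omega

lemma contiguous_cons_of_ge (hj : a + l + b ≤ j) :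
    Contiguous a l b (shiftSeq (cons j s)) ↔ Contiguous a l b (shiftSeq s) := by
  constructor
  · intro h i q k hiq hqk h1 h2 h3 h4 h5
    have := h (i + 1) (q + 1) (k + 1) (by omega) (by omega)
    simp only [shiftSeq_cons_succ, skip] at this
    split_ifs at this <;> omega
  · intro h i q k hiq hqk h1 h2 h3 h4 h5
    obtain ⟨q, rfl⟩ := Nat.exists_eq_add_of_lt (Nat.zero_lt_of_lt hiq)
    obtain ⟨k, rfl⟩ := Nat.exists_eq_add_of_lt (Nat.zero_lt_of_lt hqk)
    rcases i with _ | i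
    · rw [shiftSeq_cons_zero] at h2
      omega
    have := h i q k (by omega) (by omega)
    simp only [zero_add, shiftSeq_cons_succ, skip] at *
    split_ifs at * <;> omega

lemma contiguous_cons_of_between (h1 : a + l ≤ j) (h2 : j < a + l + (b + 1)) :
    Contiguous a l (b + 1) (shiftSeq (cons j s)) ↔ Contiguous a l b (shiftSeq s) := by
  constructor
  · intro h i q k hiq hqk h1 h2 h3 h4 h5
    have := h (i + 1) (q + 1) (k + 1) (by omega) (by omega)
    simp only [shiftSeq_cons_succ, skip] at this
    split_ifs at this <;> omega
  · intro h i q k hiq hqk h1 h2 h3 h4 h5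
    obtain ⟨q, rfl⟩ := Nat.exists_eq_add_of_lt (Nat.zero_lt_of_lt hiq)
    obtain ⟨k, rfl⟩ := Nat.exists_eq_add_of_lt (Nat.zero_lt_of_lt hqk)
    rcases i with _ | i
    · rw [shiftSeq_cons_zero] at h2
      omega
    have := h i q k (by omega) (by omega)
    simp only [zero_add, shiftSeq_cons_succ, skip] at *
    split_ifs at * <;> omega

/-- Once the block has started, nothing else may intervene: its remaining `l` values, relabelled,
must come first. -/
lemma contiguous_cons_of_mem (h1 : a ≤ j) (h2 : j < a + (l + 1)) :
    Contiguous a (l + 1) b (shiftSeq (cons j s)) ↔ Leading a l b (shiftSeq s) := by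
  constructor
  · intro h q k hqk h3 h4 h5
    have := h 0 (q + 1) (k + 1) (by omega) (by omega)
    simp only [shiftSeq_cons_zero, shiftSeq_cons_succ, skip] at this
    split_ifs at this <;> omega
  · intro h i q k hiq hqk h1 h2 h3 h4 h5
    obtain ⟨q, rfl⟩ := Nat.exists_eq_add_of_lt (Nat.zero_lt_of_lt hiq)
    obtain ⟨k, rfl⟩ := Nat.exists_eq_add_of_lt (Nat.zero_lt_of_lt hqk)
    have := h q k (by omega)
    simp only [zero_add, shiftSeq_cons_succ, skip] at h3 h4 h5 this ⊢
    split_ifs at * <;> omega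

lemma leading_cons_of_ge (hj : a + l + b ≤ j) :
    Leading a l b (shiftSeq (cons j s)) ↔ Leading a l b (shiftSeq s) := by
  constructor
  · intro h q k hqk h3 h4 h5
    have := h (q + 1) (k + 1) (by omega)
    simp only [shiftSeq_cons_succ, skip] at this
    split_ifs at this <;> omega
  · intro h q k hqk h3 h4 h5
    obtain ⟨k, rfl⟩ := Nat.exists_eq_add_of_lt (Nat.zero_lt_of_lt hqk)
    rcases q with _ | q
    · rw [shiftSeq_cons_zero] at h5
      omega
    have := h q k (by omega)
    simp only [zero_add, shiftSeq_cons_succ, skip] at *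
    split_ifs at * <;> omega

lemma leading_cons_of_mem (h1 : a ≤ j) (h2 : j < a + (l + 1)) :
    Leading a (l + 1) b (shiftSeq (cons j s)) ↔ Leading a l b (shiftSeq s) := by
  constructor
  · intro h q k hqk h3 h4 h5
    have := h (q + 1) (k + 1) (by omega)
    simp only [shiftSeq_cons_succ, skip] at this
    split_ifs at this <;> omega
  · intro h q k hqk h3 h4 h5
    obtain ⟨k, rfl⟩ := Nat.exists_eq_add_of_lt (Nat.zero_lt_of_lt hqk)
    rcases q with _ | q
    · rw [shiftSeq_cons_zero]
      omega
    have := h q k (by omega)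
    simp only [zero_add, shiftSeq_cons_succ, skip] at *
    split_ifs at * <;> omega

lemma not_leading_cons (hs : Function.Surjective (shiftSeq s))
    (h : j < a ∨ a + (l + 1) ≤ j ∧ j < a + (l + 1) + b) :
    ¬ Leading a (l + 1) b (shiftSeq (cons j s)) := by
  intro hl
  -- Relabelling by `skip j` turns this value into `a`, a member of the block. Surjectivity makes it
  -- occur, and then it is preceded by the entry `j` outside the block.
  obtain ⟨k, hk⟩ := hs (if j < a then a - 1 else a)
  have := hl 0 (k + 1) (by omega)
  simp only [shiftSeq_cons_zero, shiftSeq_cons_succ, skip, hk] at this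
  split_ifs at this <;> omega

lemma leading_zero (x : ℕ → ℕ) : Leading a 0 b x := by
  intro j k _ h1 h2
  omega

lemma renewalAt_cons {m : ℕ} :
    RenewalAt (m + 1) (shiftSeq (cons j s)) ↔ j ≤ m ∧ RenewalAt m (shiftSeq s) := by
  constructor
  · intro h
    have h0 := h 0 (by omega)
    rw [shiftSeq_cons_zero] at h0
    refine ⟨by omega, fun k hk => ?_⟩
    have := h (k + 1) (by omega)
    rw [shiftSeq_cons_succ, skip] at this
    split_ifs at this <;> omega
  · rintro ⟨hj, h⟩ k hk
    rcases k with _ | k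
    · rw [shiftSeq_cons_zero]
      omega
    · have := h k (by omega)
      rw [shiftSeq_cons_succ, skip]
      split_ifs <;> omega

end recursion

/-- An injective sequence has a renewal at `m` exactly if it maps `{0, …, m - 1}` onto itself. -/
lemma image_Iio_eq_iff_renewalAt {x : ℕ → ℕ} (hx : Function.Injective x) (m : ℕ) :
    x '' Set.Iio m = Set.Iio m ↔ RenewalAt m x := by
  constructor
  · intro h k hk
    have : x k ∈ Set.Iio m := h ▸ Set.mem_image_of_mem x hk
    exact this
  · intro h
    refine Set.Finite.eq_of_subset_of_encard_le' ?_ ?_ ?_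
    · exact Set.finite_Iio m
    · rintro _ ⟨k, hk, rfl⟩
      exact h k hk
    · rw [hx.injOn.encard_image]

/-! ### Independent samples and conditioning on the first one -/

/-- The law of a sequence of independent samples from `p`. -/
noncomputable def samples (p : PMF ℕ) : Measure (ℕ → ℕ) :=
  Measure.infinitePi (fun _ : ℕ => p.toMeasure)

instance (p : PMF ℕ) : IsProbabilityMeasure (samples p) := by
  unfold samples
  infer_instance

lemma measurable_cons : Measurable (fun x : ℕ × (ℕ → ℕ) => cons x.1 x.2) := by
  refine measurable_pi_lambda _ fun k => ?_
  rcases k with _ | k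
  · exact measurable_fst
  · exact (measurable_pi_apply k).comp measurable_snd

/-- The product measure is determined on cylinders. Padding the index set to an initial segment
allows the factor at `0` to be split off. -/
lemma map_cons_samples (p : PMF ℕ) :
    (p.toMeasure.prod (samples p)).map (fun x => cons x.1 x.2) = samples p := by
  classical
  refine Measure.eq_infinitePi _ fun s t ht => ?_
  obtain ⟨n, hn⟩ : ∃ n, s ⊆ Finset.range (n + 1) := by
    obtain ⟨n, hn⟩ := s.exists_nat_subset_range
    exact ⟨n, hn.trans (Finset.range_subset_range.2 n.le_succ)⟩
  set t' : ℕ → Set ℕ := fun i => if i ∈ s then t i else Set.univ with ht'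
  have hpi : (s : Set ℕ).pi t = (Finset.range (n + 1) : Set ℕ).pi t' := by
    ext x
    simp only [Set.mem_pi, Finset.mem_coe, ht']
    refine ⟨fun h i _ => ?_, fun h i hi => by simpa [hi] using h i (hn hi)⟩
    by_cases hi : i ∈ s <;> simp [hi, h]
  have hprod : ∏ i ∈ s, p.toMeasure (t i) = ∏ i ∈ Finset.range (n + 1), p.toMeasure (t' i) := by
    rw [← Finset.prod_subset hn (fun i _ hi => by simp [ht', hi])]
    exact Finset.prod_congr rfl fun i hi => by simp [ht', hi]
  have hpre : (fun x : ℕ × (ℕ → ℕ) => cons x.1 x.2) ⁻¹' ((Finset.range (n + 1) : Set ℕ).pi t') =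
      t' 0 ×ˢ ((Finset.range n : Set ℕ).pi fun i => t' (i + 1)) := by
    ext ⟨j, x⟩
    simp only [Set.mem_preimage, Set.mem_pi, Finset.mem_coe, Finset.mem_range, Set.mem_prod]
    constructor
    · exact fun h => ⟨h 0 (by omega), fun i hi => h (i + 1) (by omega)⟩
    · rintro ⟨h0, h⟩ i hi
      rcases i with _ | i
      · exact h0
      · exact h i (by omega)
  rw [hpi, Measure.map_apply measurable_cons (MeasurableSet.pi
    (Finset.countable_toSet _) fun i _ => .of_discrete), hpre,
    Measure.prod_prod, samples, Measure.infinitePi_pi _ (fun i _ => .of_discrete), hprod,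
    Finset.prod_range_succ', mul_comm]

/-- The first sample is independent of the rest, and the rest has the same law. The equivalence is
only required almost surely because some applications need surjectivity of the sequence. -/
lemma measure_inter_first (p : PMF ℕ) {E E' : Set (ℕ → ℕ)} (hE : MeasurableSet E) (J : Set ℕ)
    (h : ∀ᵐ s ∂samples p, ∀ j ∈ J, cons j s ∈ E ↔ s ∈ E') :
    (samples p).real (E ∩ {s | s 0 ∈ J}) = p.toMeasure.real J * (samples p).real E' := by
  have hm : MeasurableSet (E ∩ {s : ℕ → ℕ | s 0 ∈ J}) :=
    hE.inter (measurable_pi_apply 0 (MeasurableSet.of_discrete (s := J)))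
  have h1 : samples p (E ∩ {s | s 0 ∈ J}) = p.toMeasure J * samples p E' := by
    conv_lhs => rw [← map_cons_samples p, Measure.map_apply measurable_cons hm]
    rw [← Measure.prod_prod]
    refine measure_congr ?_
    filter_upwards [Measure.quasiMeasurePreserving_snd.ae h] with x hx
    refine propext ?_
    change (cons x.1 x.2 ∈ E ∧ x.1 ∈ J) ↔ (x.1 ∈ J ∧ x.2 ∈ E')
    constructor
    · exact fun hh => ⟨hh.2, (hx _ hh.2).1 hh.1⟩
    · exact fun hh => ⟨(hx _ hh.1).2 hh.2, hh.1⟩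
  rw [measureReal_def, h1, ENNReal.toReal_mul]
  rfl

lemma toMeasure_real_Iio (p : PMF ℕ) (n : ℕ) : p.toMeasure.real (Set.Iio n) = partialSum p n := by
  have : Set.Iio n = (Finset.range n : Set ℕ) := by
    ext
    simp
  rw [measureReal_def, this, PMF.toMeasure_apply_finset, partialSum,
    ENNReal.toReal_sum fun i _ => p.apply_ne_top i]

lemma toMeasure_real_Ici (p : PMF ℕ) (n : ℕ) :
    p.toMeasure.real (Set.Ici n) = 1 - partialSum p n := by
  rw [← toMeasure_real_Iio, ← Set.compl_Iio, probReal_compl_eq_one_sub .of_discrete]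

lemma toMeasure_real_Ico (p : PMF ℕ) {m n : ℕ} (h : m ≤ n) :
    p.toMeasure.real (Set.Ico m n) = partialSum p n - partialSum p m := by
  rw [← toMeasure_real_Iio, ← toMeasure_real_Iio,
    ← measureReal_sdiff (Set.Iio_subset_Iio h) .of_discrete]
  congr 1
  ext i
  simp

lemma ae_shiftSeq_surjective {p : PMF ℕ} (h0 : 0 < p 0) :
    ∀ᵐ s ∂samples p, Function.Surjective (shiftSeq s) := by
  have hm : ∀ K, MeasurableSet {s : ℕ → ℕ | ∀ k, K ≤ k → s k ≠ 0} := fun K => by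
    simp only [Set.ofPred_forall]
    exact MeasurableSet.iInter fun k => MeasurableSet.iInter fun _ =>
      (measurable_pi_apply k) (MeasurableSet.of_discrete (s := {0}ᶜ))
  have hp : 0 < partialSum p 1 := by
    simpa [partialSum] using ENNReal.toReal_pos h0.ne' (p.apply_ne_top 0)
  have key : ∀ K, (samples p).real {s : ℕ → ℕ | ∀ k, K ≤ k → s k ≠ 0} = 0 := by
    intro K
    induction K with
    | zero =>
      have := measure_inter_first p (hm 0) (Set.Ici 1) (E' := {s | ∀ k, 0 ≤ k → s k ≠ 0})
        (ae_of_all _ fun s j hj => by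
          refine ⟨fun h k _ => h (k + 1) (by omega), fun h k _ => ?_⟩
          rcases k with _ | k
          · exact Nat.one_le_iff_ne_zero.1 hj
          · exact h k (by omega))
      have hsub : {s : ℕ → ℕ | ∀ k, 0 ≤ k → s k ≠ 0} ⊆ {s | s 0 ∈ Set.Ici 1} :=
        fun s (hs : ∀ k, 0 ≤ k → s k ≠ 0) => Nat.one_le_iff_ne_zero.2 (hs 0 le_rfl)
      rw [Set.inter_eq_left.2 hsub,
        toMeasure_real_Ici] at this
      -- The probability `x` satisfies `x = (1 - N_1) x` with `N_1 > 0`, hence vanishes.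
      nlinarith
    | succ K ih =>
      have := measure_inter_first p (hm (K + 1)) Set.univ (E' := {s | ∀ k, K ≤ k → s k ≠ 0})
        (ae_of_all _ fun s j _ => by
          refine ⟨fun h k hk => h (k + 1) (by omega), fun h k hk => ?_⟩
          obtain ⟨k, rfl⟩ := Nat.exists_eq_add_of_lt (Nat.zero_lt_of_lt hk)
          exact h _ (by omega))
      rw [ih, mul_zero] at this
      simpa using this
  have h : ∀ᵐ s ∂samples p, ∀ K, ¬ ∀ k, K ≤ k → s k ≠ 0 := by
    refine ae_all_iff.2 fun K => ?_
    rw [ae_iff]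
    simpa [measureReal_eq_zero_iff] using key K
  filter_upwards [h] with s hs
  refine shiftSeq_surjective fun K => ?_
  have := hs K
  push Not at this
  exact this

lemma measureReal_split (p : PMF ℕ) (E : Set (ℕ → ℕ)) {a c n : ℕ} (h1 : a ≤ c) (h2 : c ≤ n) :
    (samples p).real E = (samples p).real (E ∩ {s | s 0 ∈ Set.Iio a}) +
      (samples p).real (E ∩ {s | s 0 ∈ Set.Ico a c}) +
      (samples p).real (E ∩ {s | s 0 ∈ Set.Ico c n}) +
      (samples p).real (E ∩ {s | s 0 ∈ Set.Ici n}) := by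
  have hJ : ∀ J : Set ℕ, MeasurableSet {s : ℕ → ℕ | s 0 ∈ J} := fun J =>
    measurable_pi_apply 0 (MeasurableSet.of_discrete (s := J))
  have e : ∀ J J' : Set ℕ, Disjoint J J' → (samples p).real (E ∩ {s | s 0 ∈ J ∪ J'}) =
      (samples p).real (E ∩ {s | s 0 ∈ J}) + (samples p).real (E ∩ {s | s 0 ∈ J'}) := by
    intro J J' h
    rw [← measureReal_inter_add_sdiff (s := E ∩ {s | s 0 ∈ J ∪ J'}) (hJ J)]
    congr 2
    · ext s
      simp only [Set.mem_inter_iff, Set.mem_ofPred_eq, Set.mem_union]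
      tauto
    · ext s
      have : s 0 ∈ J → s 0 ∉ J' := fun h' => Set.disjoint_left.1 h h'
      simp only [Set.mem_inter_iff, Set.mem_ofPred_eq, Set.mem_union, Set.mem_sdiff]
      tauto
  rw [← e _ _ (Set.disjoint_left.2 fun x => by simp; omega),
    ← e _ _ (Set.disjoint_left.2 fun x => by simp; omega),
    ← e _ _ (Set.disjoint_left.2 fun x => by simp; omega)]
  congr 1
  ext s
  simp only [Set.mem_inter_iff, Set.mem_ofPred_eq, Set.mem_union, Set.mem_Iio, Set.mem_Ico,
    Set.mem_Ici]
  refine ⟨fun h => ⟨h, by omega⟩, fun h => h.1⟩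

lemma measurableSet_shiftSeq_lt (k m : ℕ) : MeasurableSet {s : ℕ → ℕ | shiftSeq s k < m} :=
  measurable_shiftSeq k (MeasurableSet.of_discrete (s := Set.Iio m))

lemma measurableSet_le_shiftSeq (k m : ℕ) : MeasurableSet {s : ℕ → ℕ | m ≤ shiftSeq s k} :=
  measurable_shiftSeq k (MeasurableSet.of_discrete (s := Set.Ici m))

lemma measurableSet_contiguous (a l b : ℕ) :
    MeasurableSet {s : ℕ → ℕ | Contiguous a l b (shiftSeq s)} := by
  have h1 := measurableSet_shiftSeq_lt
  have h2 := measurableSet_le_shiftSeq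
  unfold Contiguous
  simp only [Set.ofPred_forall]
  refine .iInter fun i => .iInter fun j => .iInter fun k => .iInter fun _ => .iInter fun _ => ?_
  exact (h2 _ _).imp <| (h1 _ _).imp <| (h2 _ _).imp <| (h1 _ _).imp <| (h1 _ _).imp <|
    (h2 _ _).inter (h1 _ _)

lemma measurableSet_leading (a l b : ℕ) :
    MeasurableSet {s : ℕ → ℕ | Leading a l b (shiftSeq s)} := by
  have h1 := measurableSet_shiftSeq_lt
  have h2 := measurableSet_le_shiftSeq
  unfold Leading
  simp only [Set.ofPred_forall]
  refine .iInter fun j => .iInter fun k => .iInter fun _ => ?_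
  exact (h2 _ _).imp <| (h1 _ _).imp <| (h1 _ _).imp <| (h2 _ _).inter (h1 _ _)

lemma measurableSet_renewalAt (m : ℕ) :
    MeasurableSet {s : ℕ → ℕ | RenewalAt m (shiftSeq s)} := by
  unfold RenewalAt
  simp only [Set.ofPred_forall]
  exact .iInter fun k => .iInter fun _ => measurableSet_shiftSeq_lt _ _

/-! ### Recursions for the block probabilities -/

/-- The probability that the values `a, …, a + l - 1` are contiguous among those below `a + l + b`. -/
noncomputable def contiguousProb (p : PMF ℕ) (a l b : ℕ) : ℝ :=
  (samples p).real {s | Contiguous a l b (shiftSeq s)}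

/-- The probability that the values `a, …, a + l - 1` come first among those below `a + l + b`. -/
noncomputable def leadingProb (p : PMF ℕ) (a l b : ℕ) : ℝ :=
  (samples p).real {s | Leading a l b (shiftSeq s)}

lemma leadingProb_zero (p : PMF ℕ) (a b : ℕ) : leadingProb p a 0 b = 1 := by
  simp [leadingProb, leading_zero]

/-- A first sample beyond all relevant values reproduces the event. Moving that term to the left
leaves the coefficient `partialSum p (a + (l + 1) + b)`. -/
lemma leadingProb_succ {p : PMF ℕ} (h0 : 0 < p 0) (a l b : ℕ) :
    partialSum p (a + (l + 1) + b) * leadingProb p a (l + 1) b =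
      (partialSum p (a + (l + 1)) - partialSum p a) * leadingProb p a l b := by
  have hm := measurableSet_leading a (l + 1) b
  have h := measureReal_split p {s | Leading a (l + 1) b (shiftSeq s)}
    (by omega : a ≤ a + (l + 1)) (by omega : a + (l + 1) ≤ a + (l + 1) + b)
  have hs := ae_shiftSeq_surjective h0
  rw [measure_inter_first p hm (Set.Iio a) (E' := ∅)
      (by filter_upwards [hs] with s hs j hj
          simpa using not_leading_cons hs (Or.inl hj)),
    measure_inter_first p hm (Set.Ico (a + (l + 1)) (a + (l + 1) + b)) (E' := ∅)
      (by filter_upwards [hs] with s hs j hj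
          simpa using not_leading_cons hs (Or.inr hj)),
    measure_inter_first p hm (Set.Ico a (a + (l + 1))) (E' := {s | Leading a l b (shiftSeq s)})
      (ae_of_all _ fun s j hj => leading_cons_of_mem hj.1 hj.2),
    measure_inter_first p hm (Set.Ici (a + (l + 1) + b))
      (E' := {s | Leading a (l + 1) b (shiftSeq s)})
      (ae_of_all _ fun s j hj => leading_cons_of_ge hj),
    toMeasure_real_Ico p (by omega), toMeasure_real_Ici] at h
  simp only [measureReal_empty, mul_zero, zero_add, add_zero] at h
  unfold leadingProb
  linarith

/-- The truncated differences `a - 1` and `b - 1` are harmless: at `a = 0` and at `b = 0` their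
coefficients vanish. -/
lemma contiguousProb_succ (p : PMF ℕ) (a l b : ℕ) :
    partialSum p (a + (l + 1) + b) * contiguousProb p a (l + 1) b =
      partialSum p a * contiguousProb p (a - 1) (l + 1) b +
      (partialSum p (a + (l + 1) + b) - partialSum p (a + (l + 1))) *
        contiguousProb p a (l + 1) (b - 1) +
      (partialSum p (a + (l + 1)) - partialSum p a) * leadingProb p a l b := by
  have hm := measurableSet_contiguous a (l + 1) b
  have h := measureReal_split p {s | Contiguous a (l + 1) b (shiftSeq s)}
    (by omega : a ≤ a + (l + 1)) (by omega : a + (l + 1) ≤ a + (l + 1) + b)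
  rw [measure_inter_first p hm (Set.Iio a)
      (E' := {s | Contiguous (a - 1) (l + 1) b (shiftSeq s)})
      (ae_of_all _ fun s j (hj : j < a) => by
        obtain ⟨a, rfl⟩ := Nat.exists_eq_add_of_lt (Nat.zero_lt_of_lt hj)
        rw [zero_add] at *
        exact contiguous_cons_of_lt hj),
    measure_inter_first p hm (Set.Ico (a + (l + 1)) (a + (l + 1) + b))
      (E' := {s | Contiguous a (l + 1) (b - 1) (shiftSeq s)})
      (ae_of_all _ fun s j hj => by
        rw [Set.mem_Ico] at hj
        obtain ⟨b, rfl⟩ : ∃ b', b = b' + 1 := ⟨b - 1, by omega⟩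
        exact contiguous_cons_of_between hj.1 hj.2),
    measure_inter_first p hm (Set.Ico a (a + (l + 1))) (E' := {s | Leading a l b (shiftSeq s)})
      (ae_of_all _ fun s j hj => contiguous_cons_of_mem hj.1 hj.2),
    measure_inter_first p hm (Set.Ici (a + (l + 1) + b))
      (E' := {s | Contiguous a (l + 1) b (shiftSeq s)})
      (ae_of_all _ fun s j hj => contiguous_cons_of_ge hj),
    toMeasure_real_Ico p (by omega), toMeasure_real_Ico p (by omega), toMeasure_real_Ici,
    toMeasure_real_Iio] at h
  unfold contiguousProb leadingProb
  linarith

/-! ### Transfer to permutations of finite sets -/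

/-- Projection keeps the relative order of positions, so contiguity says that the block occupies an
order-convex set of positions of `Fin (a + l + b)`. For a nonempty block this set is the interval
from its least to its greatest position. -/
lemma proj_mem_cluster_iff (σ : Equiv.Perm ℕ) (a b : ℕ) {l : ℕ} (hl : 0 < l) :
    proj (a + l + b) σ ∈ cluster (a + l + b) l (a + 1) ↔ Contiguous a l b σ := by
  classical
  set τ := proj (a + l + b) σ with hτ
  have hmono : StrictMono fun i => σ.symm (τ i : ℕ) :=
    (Tuple.monotone_sort fun v : Fin (a + l + b) => σ.symm (v : ℕ)).strictMono_of_injective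
      (σ.symm.injective.comp (Fin.val_injective.comp τ.injective))
  have hpos : ∀ q, σ q < a + l + b → ∃ i, (τ i : ℕ) = σ q ∧ σ.symm (τ i : ℕ) = q := fun q hq =>
    ⟨τ.symm ⟨σ q, hq⟩, by simp, by simp⟩
  constructor
  · rintro ⟨-, -, m, -, h⟩ i j k hij hjk h1 h2 h3 h4 h5
    obtain ⟨i', hi, hi'⟩ := hpos i (by omega)
    obtain ⟨j', hj, hj'⟩ := hpos j (by omega)
    obtain ⟨k', hk, hk'⟩ := hpos k (by omega)
    have hij' : i' < j' := hmono.lt_iff_lt.1 (by simpa [hi', hj'] using hij)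
    have hjk' : j' < k' := hmono.lt_iff_lt.1 (by simpa [hk', hj'] using hjk)
    rw [Fin.lt_def] at hij' hjk'
    have e1 := (h i').2 (by omega)
    have e2 := (h k').2 (by omega)
    have e3 := (h j').1 (by omega)
    omega
  · intro h
    refine ⟨by omega, by omega, ?_⟩
    set S : Finset (Fin (a + l + b)) := {i | a ≤ (τ i : ℕ) ∧ (τ i : ℕ) < a + l} with hS
    have hmem : ∀ i, i ∈ S ↔ a ≤ (τ i : ℕ) ∧ (τ i : ℕ) < a + l := fun i => by simp [hS]
    have hcard : S.card = l := by
      have : S.map (τ.toEmbedding.trans Fin.valEmbedding) = Finset.Ico a (a + l) := by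
        ext v
        simp only [Finset.mem_map, hmem, Finset.mem_Ico, Function.Embedding.trans_apply,
          Equiv.coe_toEmbedding, Fin.valEmbedding_apply]
        constructor
        · rintro ⟨i, hi, rfl⟩
          exact hi
        · intro hv
          exact ⟨τ.symm ⟨v, by omega⟩, by simpa using hv, by simp⟩
      rw [← Finset.card_map (τ.toEmbedding.trans Fin.valEmbedding), this, Nat.card_Ico]
      omega
    have hne : S.Nonempty := Finset.card_pos.1 (by omega)
    have hIcc : S = Finset.Icc (S.min' hne) (S.max' hne) := by
      ext i
      rw [Finset.mem_Icc]
      refine ⟨fun hi => ⟨S.min'_le _ hi, S.le_max' _ hi⟩, fun hi => ?_⟩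
      have h1 := S.min'_mem hne
      have h2 := S.max'_mem hne
      rcases hi.1.eq_or_lt with e | e
      · rwa [← e]
      rcases hi.2.eq_or_lt with e' | e'
      · rwa [e']
      rw [hmem] at h1 h2 ⊢
      have := h _ _ _ (hmono e) (hmono e')
      simp only [Equiv.apply_symm_apply] at this
      exact this h1.1 h1.2 h2.1 h2.2 (τ i).2
    have hcard' := hcard
    rw [hIcc, Fin.card_Icc] at hcard'
    refine ⟨S.min' hne, by omega, fun i => ?_⟩
    have := hmem i
    rw [hIcc, Finset.mem_Icc, Fin.le_def, Fin.le_def] at this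
    omega

lemma shiftPerm_coe {s : ℕ → ℕ} (hs : Function.Surjective (shiftSeq s)) :
    (shiftPerm s : ℕ → ℕ) = shiftSeq s := by
  rw [shiftPerm, dif_pos ⟨shiftSeq_injective s, hs⟩]
  rfl

lemma pShiftedFin_real_cluster {p : PMF ℕ} (h0 : 0 < p 0) (a b : ℕ) {l : ℕ} (hl : 0 < l) :
    (pShiftedFin p (a + l + b)).real (cluster (a + l + b) l (a + 1)) = contiguousProb p a l b := by
  have hm : MeasurableSet (cluster (a + l + b) l (a + 1)) := trivial
  rw [contiguousProb, measureReal_def, measureReal_def, pShiftedFin, pShifted,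
    Measure.map_apply (measurable_proj _) hm,
    Measure.map_apply measurable_shiftPerm (measurable_proj _ hm)]
  congr 1
  refine measure_congr ?_
  filter_upwards [ae_shiftSeq_surjective h0] with s hs
  refine propext ((proj_mem_cluster_iff (shiftPerm s) a b hl).trans ?_)
  rw [shiftPerm_coe hs]
  rfl

instance (p : PMF ℕ) (n : ℕ) : IsProbabilityMeasure (pShiftedFin p n) :=
  have : IsProbabilityMeasure (pShifted p) :=
    Measure.isProbabilityMeasure_map (μ := samples p) measurable_shiftPerm.aemeasurable
  Measure.isProbabilityMeasure_map (measurable_proj n).aemeasurable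

lemma pShiftedFin_real_cluster_zero (p : PMF ℕ) {n k : ℕ} (hk : 1 ≤ k) (hn : k ≤ n + 1) :
    (pShiftedFin p n).real (cluster n 0 k) = 1 := by
  have : cluster n 0 k = Set.univ := by
    refine Set.eq_univ_of_forall fun σ => ⟨hk, hn, 0, by omega, fun i => ?_⟩
    omega
  rw [this, probReal_univ]

/-! ### Renewals and the expectation of the first renewal -/

/-- The probability that there is no renewal at `1, …, j`. -/
noncomputable def noRenewalProb (p : PMF ℕ) (j : ℕ) : ℝ :=
  (samples p).real {s | ∀ i, 1 ≤ i → i ≤ j → ¬ RenewalAt i (shiftSeq s)}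

lemma measurableSet_lastRenewal (m j : ℕ) : MeasurableSet {s : ℕ → ℕ |
    RenewalAt m (shiftSeq s) ∧ ∀ i, 1 ≤ i → i ≤ j → ¬ RenewalAt (m + i) (shiftSeq s)} := by
  have : MeasurableSet {s : ℕ → ℕ | ∀ i, 1 ≤ i → i ≤ j → ¬ RenewalAt (m + i) (shiftSeq s)} := by
    simp only [Set.ofPred_forall]
    exact .iInter fun i => .iInter fun _ => .iInter fun _ => (measurableSet_renewalAt _).compl
  exact (measurableSet_renewalAt m).inter this

lemma renewalAt_zero (x : ℕ → ℕ) : RenewalAt 0 x := fun _ h => absurd h (Nat.not_lt_zero _)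

/-- By induction on `m`: a renewal at `m + 1` forces the first sample to be at most `m` and leaves a
renewal at `m`, which contributes the factor `partialSum p (m + 1)`. -/
lemma lastRenewalProb (p : PMF ℕ) (m j : ℕ) :
    (samples p).real {s : ℕ → ℕ |
      RenewalAt m (shiftSeq s) ∧ ∀ i, 1 ≤ i → i ≤ j → ¬ RenewalAt (m + i) (shiftSeq s)} =
    (∏ i ∈ Finset.range m, partialSum p (i + 1)) * noRenewalProb p j := by
  induction m with
  | zero => simp [noRenewalProb, renewalAt_zero]
  | succ m ih =>
    have h := measure_inter_first p (measurableSet_lastRenewal (m + 1) j) (Set.Iio (m + 1))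
      (E' := {s : ℕ → ℕ |
        RenewalAt m (shiftSeq s) ∧ ∀ i, 1 ≤ i → i ≤ j → ¬ RenewalAt (m + i) (shiftSeq s)})
      (ae_of_all _ fun s i (hi : i < m + 1) => by
        simp only [Set.mem_ofPred_eq, Nat.succ_add m, renewalAt_cons]
        refine and_congr (by simp; omega) (forall_congr' fun q => forall_congr' fun _ =>
          forall_congr' fun _ => ?_)
        simp only [not_and]
        exact ⟨fun h => h (by omega), fun h _ => h⟩)
    rw [Set.inter_eq_left.2, ih, toMeasure_real_Iio] at h
    · rw [h, Finset.prod_range_succ]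
      ring
    · rintro s ⟨hs, -⟩
      have := hs 0 (by omega)
      rwa [shiftSeq_zero] at this

/-- The decomposition according to the last renewal up to `n`. -/
lemma sum_prod_mul_noRenewalProb (p : PMF ℕ) (n : ℕ) :
    ∑ m ∈ Finset.range (n + 1),
      (∏ i ∈ Finset.range m, partialSum p (i + 1)) * noRenewalProb p (n - m) = 1 := by
  classical
  simp only [← lastRenewalProb]
  rw [← measureReal_biUnion_finset]
  · convert probReal_univ (μ := samples p)
    refine Set.eq_univ_of_forall fun s => ?_
    rw [Set.mem_iUnion₂]
    refine ⟨Nat.findGreatest (fun m => RenewalAt m (shiftSeq s)) n, ?_, ?_, ?_⟩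
    · exact Finset.mem_range.2 (Nat.lt_succ_of_le (Nat.findGreatest_le n))
    · exact Nat.findGreatest_spec (P := fun m => RenewalAt m (shiftSeq s)) (Nat.zero_le n)
        (renewalAt_zero _)
    · intro i hi hin
      have := Nat.findGreatest_le (P := fun m => RenewalAt m (shiftSeq s)) n
      exact Nat.findGreatest_is_greatest (P := fun m => RenewalAt m (shiftSeq s)) (n := n)
        (by omega) (by omega)
  · intro m hm q hq hmq
    have hm' := Finset.mem_range.1 (Finset.mem_coe.1 hm)
    have hq' := Finset.mem_range.1 (Finset.mem_coe.1 hq)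
    refine Set.disjoint_left.2 ?_
    rintro s ⟨h1, h2⟩ ⟨h3, h4⟩
    rcases lt_or_gt_of_ne hmq with h | h
    · refine h2 (q - m) (by omega) (by omega) ?_
      rwa [Nat.add_sub_cancel' h.le]
    · refine h4 (m - q) (by omega) (by omega) ?_
      rwa [Nat.add_sub_cancel' h.le]
  · exact fun m _ => measurableSet_lastRenewal _ _

lemma measurable_firstRenewal : Measurable firstRenewal := by
  refine .iInf fun m => ?_
  have hm : MeasurableSet {σ : Equiv.Perm ℕ | 1 ≤ m ∧ σ '' Set.Iio m = Set.Iio m} := by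
    have : {σ : Equiv.Perm ℕ | 1 ≤ m ∧ σ '' Set.Iio m = Set.Iio m} =
        {σ : Equiv.Perm ℕ | 1 ≤ m ∧ ∀ k, k < m → σ k < m} := by
      ext σ
      exact and_congr_right fun _ => image_Iio_eq_iff_renewalAt σ.injective m
    rw [this]
    have hk : ∀ k, Measurable fun σ : Equiv.Perm ℕ => σ k := fun k =>
      (measurable_pi_apply k).comp (comap_measurable fun σ : Equiv.Perm ℕ => (σ : ℕ → ℕ))
    have h2 : MeasurableSet {σ : Equiv.Perm ℕ | ∀ k, k < m → σ k < m} := by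
      simp only [Set.ofPred_forall]
      exact .iInter fun k => .iInter fun _ => hk k (MeasurableSet.of_discrete (s := Set.Iio m))
    exact (MeasurableSet.const _).inter h2
  classical
  simp only [iInf_eq_if]
  exact Measurable.ite hm measurable_const measurable_const

/-- This is `T_1 = ∑ 1{T_1 > j}`; integrating it gives the expectation as the sum of the
probabilities `noRenewalProb p j`. -/
lemma firstRenewal_eq_tsum (σ : Equiv.Perm ℕ) :
    firstRenewal σ = ∑' j : ℕ,
      {j | ∀ i, 1 ≤ i → i ≤ j → ¬ RenewalAt i σ}.indicator (fun _ => (1 : ℝ≥0∞)) j := by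
  classical
  simp only [firstRenewal, image_Iio_eq_iff_renewalAt σ.injective]
  by_cases h : ∃ m, 1 ≤ m ∧ RenewalAt m σ
  · have hT := Nat.find_spec h
    have h1 : (⨅ (m : ℕ) (_ : 1 ≤ m ∧ RenewalAt m σ), (m : ℝ≥0∞)) = (Nat.find h : ℕ) := by
      refine le_antisymm (iInf₂_le (Nat.find h) hT) (le_iInf₂ fun m hm => ?_)
      exact_mod_cast Nat.find_min' h hm
    have h2 : {j | ∀ i, 1 ≤ i → i ≤ j → ¬ RenewalAt i σ} = (Finset.range (Nat.find h) : Set ℕ) := by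
      ext j
      simp only [Set.mem_ofPred_eq, Finset.coe_range, Set.mem_Iio]
      refine ⟨fun hj => ?_, fun hj i hi hij hr => ?_⟩
      · by_contra hc
        exact hj _ hT.1 (by omega) hT.2
      · exact Nat.find_min h (by omega) ⟨hi, hr⟩
    rw [h1, h2, tsum_eq_sum (s := Finset.range (Nat.find h)) (fun j hj => by
      rw [Set.indicator_of_notMem (by simpa using hj)])]
    rw [Finset.sum_congr rfl fun j hj => Set.indicator_of_mem (Finset.mem_coe.2 hj) _]
    simp
  · push Not at h
    have h1 : (⨅ (m : ℕ) (_ : 1 ≤ m ∧ RenewalAt m σ), (m : ℝ≥0∞)) = ⊤ := by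
      simp only [iInf_eq_top]
      exact fun m hm => absurd hm.2 (h m hm.1)
    have h2 : {j | ∀ i, 1 ≤ i → i ≤ j → ¬ RenewalAt i σ} = Set.univ :=
      Set.eq_univ_of_forall fun j i hi _ => h i hi
    rw [h1, h2]
    simp

lemma positiveRecurrent_iff_summable {p : PMF ℕ} (h0 : 0 < p 0) :
    PositiveRecurrent p ↔ Summable (noRenewalProb p) := by
  have hm : ∀ j, MeasurableSet {s : ℕ → ℕ | ∀ i, 1 ≤ i → i ≤ j → ¬ RenewalAt i (shiftSeq s)} := by
    intro j
    simp only [Set.ofPred_forall]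
    exact .iInter fun i => .iInter fun _ => .iInter fun _ => (measurableSet_renewalAt _).compl
  have h : ∫⁻ σ, firstRenewal σ ∂(pShifted p) = ∑' j, ENNReal.ofReal (noRenewalProb p j) := by
    rw [pShifted, lintegral_map measurable_firstRenewal measurable_shiftPerm]
    change ∫⁻ s, firstRenewal (shiftPerm s) ∂(samples p) = _
    have hae : (fun s => firstRenewal (shiftPerm s)) =ᵐ[samples p] fun s => ∑' j : ℕ,
        {s : ℕ → ℕ | ∀ i, 1 ≤ i → i ≤ j → ¬ RenewalAt i (shiftSeq s)}.indicator
          (fun _ => (1 : ℝ≥0∞)) s := by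
      filter_upwards [ae_shiftSeq_surjective h0] with s hs
      rw [firstRenewal_eq_tsum, shiftPerm_coe hs]
      rfl
    rw [lintegral_congr_ae hae, lintegral_tsum fun j =>
      (measurable_const.indicator (hm j)).aemeasurable]
    refine tsum_congr fun j => ?_
    rw [lintegral_indicator_const (hm j), one_mul, noRenewalProb, measureReal_def,
      ENNReal.ofReal_toReal (measure_ne_top _ _)]
  rw [PositiveRecurrent, h, lt_top_iff_ne_top]
  refine ⟨fun ht => ?_, fun hs => hs.tsum_ofReal_ne_top⟩
  have := ENNReal.summable_toReal ht
  refine this.congr fun j => ?_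
  rw [ENNReal.toReal_ofReal]
  exact measureReal_nonneg

/-! ### The infinite product, the mean and positive recurrence -/

section partialSum

variable (p : PMF ℕ)

lemma partialSum_zero : partialSum p 0 = 0 := by simp [partialSum]

lemma partialSum_mono : Monotone (partialSum p) := by
  refine monotone_nat_of_le_succ fun n => ?_
  rw [partialSum, partialSum, Finset.sum_range_succ]
  exact le_add_of_nonneg_right ENNReal.toReal_nonneg

lemma partialSum_le_one (n : ℕ) : partialSum p n ≤ 1 := by
  rw [← toMeasure_real_Iio]
  exact measureReal_le_one

lemma partialSum_nonneg (n : ℕ) : 0 ≤ partialSum p n := by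
  rw [← toMeasure_real_Iio]
  exact measureReal_nonneg

variable {p}

lemma partialSum_pos (h0 : 0 < p 0) {n : ℕ} (hn : 0 < n) : 0 < partialSum p n := by
  have : 0 < partialSum p 1 := by
    simpa [partialSum] using ENNReal.toReal_pos h0.ne' (p.apply_ne_top 0)
  exact this.trans_le (partialSum_mono p hn)

lemma hasSum_toReal (p : PMF ℕ) : HasSum (fun i => (p i).toReal) 1 := by
  have := ENNReal.hasSum_toReal (f := p) (by simp)
  rwa [← ENNReal.tsum_toReal_eq p.apply_ne_top, p.tsum_coe, ENNReal.toReal_one] at this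

lemma tendsto_partialSum (p : PMF ℕ) : Tendsto (partialSum p) atTop (𝓝 1) :=
  (hasSum_toReal p).tendsto_sum_nat

/-- The product `N_1 ⋯ N_m` of the first partial sums. -/
noncomputable def prodPartialSum (p : PMF ℕ) (m : ℕ) : ℝ :=
  ∏ i ∈ Finset.range m, partialSum p (i + 1)

lemma prodPartialSum_pos (h0 : 0 < p 0) (m : ℕ) : 0 < prodPartialSum p m :=
  Finset.prod_pos fun i _ => partialSum_pos h0 i.succ_pos

lemma prodPartialSum_antitone (h0 : 0 < p 0) : Antitone (prodPartialSum p) := by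
  refine antitone_nat_of_succ_le fun n => ?_
  rw [prodPartialSum, Finset.prod_range_succ]
  exact mul_le_of_le_one_right (prodPartialSum_pos h0 n).le (partialSum_le_one p _)

lemma multipliable_partialSum (p : PMF ℕ) : Multipliable fun j : ℕ => partialSum p (j + 1) := by
  have hanti : Antitone fun s : Finset ℕ => ∏ j ∈ s, partialSum p (j + 1) := fun s t hst => by
    dsimp only
    rw [← Finset.prod_sdiff hst]
    exact mul_le_of_le_one_left (Finset.prod_nonneg fun i _ => partialSum_nonneg p _)
      (Finset.prod_le_one (fun i _ => partialSum_nonneg p _) fun i _ => partialSum_le_one p _)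
  have hb : BddBelow (Set.range fun s : Finset ℕ => ∏ j ∈ s, partialSum p (j + 1)) :=
    ⟨0, by rintro _ ⟨s, rfl⟩; exact Finset.prod_nonneg fun i _ => partialSum_nonneg p _⟩
  exact ⟨_, tendsto_atTop_ciInf hanti hb⟩

lemma tendsto_prodPartialSum (p : PMF ℕ) :
    Tendsto (prodPartialSum p) atTop (𝓝 (∏' j : ℕ, partialSum p (j + 1))) :=
  (multipliable_partialSum p).hasProd.tendsto_prod_nat

lemma tprod_partialSum_nonneg (p : PMF ℕ) : 0 ≤ ∏' j : ℕ, partialSum p (j + 1) :=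
  ge_of_tendsto' (tendsto_prodPartialSum p) fun _ =>
    Finset.prod_nonneg fun _ _ => partialSum_nonneg p _

lemma tprod_partialSum_le (h0 : 0 < p 0) (m : ℕ) :
    ∏' j : ℕ, partialSum p (j + 1) ≤ prodPartialSum p m :=
  (prodPartialSum_antitone h0).le_of_tendsto (tendsto_prodPartialSum p) m

lemma tprod_partialSum_pos_iff_summable (h0 : 0 < p 0) :
    0 < ∏' j : ℕ, partialSum p (j + 1) ↔ Summable fun j => 1 - partialSum p (j + 1) := by
  constructor
  · intro h
    refine summable_of_sum_range_le (c := 1 / ∏' j : ℕ, partialSum p (j + 1))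
      (fun j => sub_nonneg.2 (partialSum_le_one p _)) fun n => ?_
    rw [le_div_iff₀' h]
    -- The product up to `n` loses `prodPartialSum p n * (1 - partialSum p (n + 1))` in the next
    -- step, which is at least the infinite product times the tail. The losses telescope.
    have key : ∀ n, (∏' j : ℕ, partialSum p (j + 1)) *
        ∑ j ∈ Finset.range n, (1 - partialSum p (j + 1)) ≤ 1 - prodPartialSum p n := by
      intro n
      induction n with
      | zero => simp [prodPartialSum]
      | succ n ih =>
        have e : prodPartialSum p (n + 1) = prodPartialSum p n * partialSum p (n + 1) :=
          Finset.prod_range_succ _ _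
        rw [Finset.sum_range_succ, e]
        nlinarith [mul_le_mul_of_nonneg_right (tprod_partialSum_le h0 n)
          (sub_nonneg.2 (partialSum_le_one p (n + 1)))]
    linarith [key n, prodPartialSum_pos h0 n]
  · intro h
    refine lt_of_le_of_ne (tprod_partialSum_nonneg p) (Ne.symm ?_)
    have := tprod_one_add_ne_zero_of_summable (R := ℝ) (f := fun j => -(1 - partialSum p (j + 1)))
      (fun j => by
        have := partialSum_pos h0 j.succ_pos
        simpa using this.ne') (by simpa [abs_sub_comm] using h.norm)
    simpa using this

/-- The tail at `j` sums the weights with index at least `j`; after exchanging sums, the weight at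
`i` is counted once for each `j ≤ i`. -/
lemma tsum_ofReal_one_sub_partialSum (p : PMF ℕ) :
    ∑' j : ℕ, ENNReal.ofReal (1 - partialSum p j) = ∑' i : ℕ, ((i + 1 : ℕ) : ℝ≥0∞) * p i := by
  classical
  have h1 : ∀ j, ENNReal.ofReal (1 - partialSum p j) = ∑' i, if j ≤ i then p i else 0 := by
    intro j
    rw [← toMeasure_real_Ici, measureReal_def, ENNReal.ofReal_toReal (measure_ne_top _ _),
      PMF.toMeasure_apply _ .of_discrete]
    refine tsum_congr fun i => ?_
    simp [Set.indicator_apply]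
  simp only [h1]
  rw [ENNReal.tsum_comm]
  refine tsum_congr fun i => ?_
  rw [tsum_eq_sum (s := Finset.range (i + 1)) (fun j hj => if_neg (by simpa using hj)),
    Finset.sum_congr rfl fun j hj => if_pos (by simpa [Nat.lt_succ_iff] using hj)]
  simp

lemma summable_one_sub_partialSum_iff (p : PMF ℕ) :
    (Summable fun j => 1 - partialSum p (j + 1)) ↔
      ∑' i : ℕ, ((i + 1 : ℕ) : ℝ≥0∞) * p i < ∞ := by
  rw [summable_nat_add_iff (f := fun j => 1 - partialSum p j) 1, ← tsum_ofReal_one_sub_partialSum,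
    lt_top_iff_ne_top]
  refine ⟨fun h => h.tsum_ofReal_ne_top, fun h => ?_⟩
  refine (ENNReal.summable_toReal h).congr fun j => ?_
  rw [ENNReal.toReal_ofReal (sub_nonneg.2 (partialSum_le_one p _))]

lemma tprod_partialSum_pos_iff (h0 : 0 < p 0) :
    0 < ∏' j : ℕ, partialSum p (j + 1) ↔ ∑' i : ℕ, ((i + 1 : ℕ) : ℝ≥0∞) * p i < ∞ :=
  (tprod_partialSum_pos_iff_summable h0).trans (summable_one_sub_partialSum_iff p)

lemma noRenewalProb_nonneg (p : PMF ℕ) (j : ℕ) : 0 ≤ noRenewalProb p j := measureReal_nonneg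

lemma positiveRecurrent_iff_tprod_pos (h0 : 0 < p 0) :
    PositiveRecurrent p ↔ 0 < ∏' j : ℕ, partialSum p (j + 1) := by
  rw [positiveRecurrent_iff_summable h0]
  have hsum : ∀ n, ∑ m ∈ Finset.range (n + 1), prodPartialSum p (n - m) * noRenewalProb p m = 1 := by
    intro n
    rw [← sum_prod_mul_noRenewalProb p n, ← Finset.sum_range_reflect]
    refine Finset.sum_congr rfl fun m hm => ?_
    have := Finset.mem_range.1 hm
    rw [show n - (n + 1 - 1 - m) = m by omega, show n + 1 - 1 - m = n - m by omega]
    rfl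
  constructor
  · intro hs
    refine lt_of_le_of_ne (tprod_partialSum_nonneg p) fun h => ?_
    -- If the product were zero, each term of the last-renewal decomposition would tend to zero,
    -- dominated by the summable `noRenewalProb p`. But the terms always add up to one.
    have hlim : Tendsto (fun n => ∑' m,
        if m ≤ n then prodPartialSum p (n - m) * noRenewalProb p m else 0) atTop
        (𝓝 (∑' _ : ℕ, (0 : ℝ))) := by
      refine tendsto_tsum_of_dominated_convergence hs (fun m => ?_) (.of_forall fun n m => ?_)
      · have h1 := ((tendsto_prodPartialSum p).comp (tendsto_sub_atTop_nat m)).mul_const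
          (noRenewalProb p m)
        rw [← h, zero_mul] at h1
        refine h1.congr' ?_
        filter_upwards [eventually_ge_atTop m] with n hn
        rw [if_pos hn]
        rfl
      · split_ifs
        · rw [Real.norm_of_nonneg (mul_nonneg (prodPartialSum_pos h0 _).le
            (noRenewalProb_nonneg p m))]
          refine mul_le_of_le_one_left (noRenewalProb_nonneg p m) ?_
          simpa [prodPartialSum] using prodPartialSum_antitone h0 (Nat.zero_le (n - m))
        · simpa using noRenewalProb_nonneg p m
    rw [tsum_zero] at hlim
    have hone : (fun n => ∑' m,
        if m ≤ n then prodPartialSum p (n - m) * noRenewalProb p m else 0) = fun _ => (1 : ℝ) := by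
      funext n
      rw [← hsum n, tsum_eq_sum (s := Finset.range (n + 1)) (fun j hj => if_neg (by simpa using hj)),
        Finset.sum_congr rfl fun j hj => if_pos (by simpa [Nat.lt_succ_iff] using hj)]
    rw [hone] at hlim
    exact one_ne_zero (tendsto_nhds_unique tendsto_const_nhds hlim)
  · intro h
    refine summable_of_sum_range_le (c := 1 / ∏' j : ℕ, partialSum p (j + 1))
      (noRenewalProb_nonneg p) fun n => ?_
    -- Every renewal probability is at least the infinite product, so the decomposition bounds the
    -- partial sums.
    rw [le_div_iff₀' h, ← hsum n, Finset.mul_sum]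
    refine (Finset.sum_le_sum fun m _ => mul_le_mul_of_nonneg_right
      (tprod_partialSum_le h0 (n - m)) (noRenewalProb_nonneg p m)).trans ?_
    exact Finset.sum_le_sum_of_subset_of_nonneg (Finset.range_subset_range.2 n.le_succ)
      fun m _ _ => mul_nonneg (prodPartialSum_pos h0 _).le (noRenewalProb_nonneg p m)

end partialSum

variable {p : PMF ℕ}

/-! ### Estimates for leading blocks -/

lemma leadingProb_eq (h0 : 0 < p 0) (a l b : ℕ) :
    leadingProb p a l b = ∏ i ∈ Finset.range l,
      (partialSum p (a + (i + 1)) - partialSum p a) / partialSum p (a + (i + 1) + b) := by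
  induction l with
  | zero => simp [leadingProb_zero]
  | succ l ih =>
    have h := leadingProb_succ h0 a l b
    have hp := partialSum_pos h0 (n := a + (l + 1) + b) (by omega)
    rw [Finset.prod_range_succ, ← ih, mul_div_assoc', eq_div_iff hp.ne']
    linarith

lemma leadingProb_nonneg (a l b : ℕ) : 0 ≤ leadingProb p a l b := measureReal_nonneg

lemma contiguousProb_le_one (a l b : ℕ) : contiguousProb p a l b ≤ 1 := measureReal_le_one

lemma contiguousProb_nonneg (a l b : ℕ) : 0 ≤ contiguousProb p a l b := measureReal_nonneg

lemma leadingProb_antitone (h0 : 0 < p 0) (a l : ℕ) : Antitone (leadingProb p a l) := by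
  intro b b' hb
  rw [leadingProb_eq h0, leadingProb_eq h0]
  have h := partialSum_mono p
  refine Finset.prod_le_prod (fun i _ => div_nonneg (sub_nonneg.2 (h (by omega)))
    (partialSum_nonneg p _)) fun i _ => ?_
  exact div_le_div_of_nonneg_left (sub_nonneg.2 (h (by omega)))
    (partialSum_pos h0 (by omega)) (h (by omega))

lemma prodPartialSum_le_leadingProb (h0 : 0 < p 0) (l b : ℕ) :
    prodPartialSum p l ≤ leadingProb p 0 l b := by
  rw [leadingProb_eq h0]
  refine Finset.prod_le_prod (fun i _ => partialSum_nonneg p _) fun i _ => ?_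
  rw [partialSum_zero, sub_zero, zero_add]
  exact le_div_self (partialSum_nonneg p _) (partialSum_pos h0 (by omega)) (partialSum_le_one p _)

lemma tendsto_leadingProb_zero (h0 : 0 < p 0) (l : ℕ) :
    Tendsto (leadingProb p 0 l) atTop (𝓝 (prodPartialSum p l)) := by
  have h : ∀ i ∈ Finset.range l, Tendsto (fun b =>
      (partialSum p (0 + (i + 1)) - partialSum p 0) / partialSum p (0 + (i + 1) + b)) atTop
      (𝓝 (partialSum p (i + 1))) := fun i _ => by
    have h1 := (tendsto_partialSum p).comp (tendsto_add_atTop_nat (i + 1))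
    have h2 := (tendsto_const_nhds (x := partialSum p (i + 1))).div h1 one_ne_zero
    rw [div_one] at h2
    refine h2.congr fun b => ?_
    rw [Pi.div_apply, partialSum_zero, sub_zero, zero_add, Function.comp_apply, add_comm b]
  refine (tendsto_finsetProd _ h).congr fun b => ?_
  rw [leadingProb_eq h0]

/-- While a smaller value is missing, the least available number lies outside the block. It must be
avoided at each of the `l` steps, so every factor is at most `1 - partialSum p 1`. -/
lemma leadingProb_le_pow (h0 : 0 < p 0) {a : ℕ} (ha : 0 < a) (l b : ℕ) :
    leadingProb p a l b ≤ (1 - partialSum p 1) ^ l := by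
  have h := partialSum_mono p
  rw [leadingProb_eq h0, ← Finset.card_range l, ← Finset.prod_const, Finset.card_range]
  refine Finset.prod_le_prod (fun i _ => div_nonneg (sub_nonneg.2 (h (by omega)))
    (partialSum_nonneg p _)) fun i _ => ?_
  have hp := partialSum_pos h0 (n := a + (i + 1) + b) (by omega)
  rw [div_le_iff₀ hp]
  have h1 : partialSum p 1 ≤ partialSum p a := h (by omega)
  have h2 : partialSum p (a + (i + 1)) ≤ partialSum p (a + (i + 1) + b) := h (by omega)
  nlinarith [partialSum_le_one p (a + (i + 1) + b), partialSum_nonneg p 1]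

/-! ### Comparison bounds from the recursion -/

/-- Further larger values give further chances to interrupt the block. Monotonicity in `b` makes the
limit in `n` exist for fixed `k`. -/
lemma contiguousProb_antitone (h0 : 0 < p 0) (a l : ℕ) :
    Antitone (contiguousProb p a (l + 1)) := by
  have hN := partialSum_mono p
  have step : ∀ a b, partialSum p a * contiguousProb p (a - 1) (l + 1) (b + 1) ≤
        partialSum p a * contiguousProb p (a - 1) (l + 1) b →
      (partialSum p (a + (l + 1) + b) - partialSum p (a + (l + 1))) *
        contiguousProb p a (l + 1) b ≤
        (partialSum p (a + (l + 1) + b) - partialSum p (a + (l + 1))) *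
        contiguousProb p a (l + 1) (b - 1) →
      contiguousProb p a (l + 1) (b + 1) ≤ contiguousProb p a (l + 1) b := by
    intro a b h1 h2
    have e1 := contiguousProb_succ p a l b
    have e2 := contiguousProb_succ p a l (b + 1)
    have h3 := mul_le_mul_of_nonneg_left (leadingProb_antitone h0 a l b.le_succ)
      (sub_nonneg.2 (hN (by omega : a ≤ a + (l + 1))))
    rw [Nat.add_sub_cancel] at e2
    refine le_of_mul_le_mul_left ?_ (partialSum_pos h0 (n := a + (l + 1) + (b + 1)) (by omega))
    rw [Nat.succ_eq_add_one] at h3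
    linarith
  have key : ∀ a b, contiguousProb p a (l + 1) (b + 1) ≤ contiguousProb p a (l + 1) b := by
    intro a
    induction a with
    | zero =>
      intro b
      induction b with
      | zero => exact step 0 0 (by simp [partialSum_zero]) (by simp)
      | succ b ih =>
        exact step 0 (b + 1) (by simp [partialSum_zero])
          (mul_le_mul_of_nonneg_left ih (sub_nonneg.2 (hN (by omega))))
    | succ a iha =>
      intro b
      have h := mul_le_mul_of_nonneg_left (iha b) (partialSum_nonneg p (a + 1))
      induction b with
      | zero => exact step (a + 1) 0 h (by simp)
      | succ b ih =>
        exact step (a + 1) (b + 1) h (mul_le_mul_of_nonneg_left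
          (ih (mul_le_mul_of_nonneg_left (iha b) (partialSum_nonneg p (a + 1))))
          (sub_nonneg.2 (hN (by omega))))
  exact antitone_nat_of_succ_le (key a)

/-- A supersolution of the recursion bounds the probability from above. -/
lemma contiguousProb_le_of_supersolution (h0 : 0 < p 0) (l b₀ : ℕ) (E : ℕ → ℕ → ℝ)
    (hE : ∀ a b, b ≤ b₀ → contiguousProb p a (l + 1) b ≤ E a b ∨
      partialSum p a * E (a - 1) b +
      (partialSum p (a + (l + 1) + b) - partialSum p (a + (l + 1))) * E a (b - 1) +
      (partialSum p (a + (l + 1)) - partialSum p a) * leadingProb p a l b ≤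
      partialSum p (a + (l + 1) + b) * E a b) (a b : ℕ) (hb : b ≤ b₀) :
    contiguousProb p a (l + 1) b ≤ E a b := by
  have hN := partialSum_mono p
  have step : ∀ a b, b ≤ b₀ → partialSum p a * contiguousProb p (a - 1) (l + 1) b ≤
        partialSum p a * E (a - 1) b →
      (partialSum p (a + (l + 1) + b) - partialSum p (a + (l + 1))) *
        contiguousProb p a (l + 1) (b - 1) ≤
        (partialSum p (a + (l + 1) + b) - partialSum p (a + (l + 1))) * E a (b - 1) →
      contiguousProb p a (l + 1) b ≤ E a b := by
    intro a b hb h1 h2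
    rcases hE a b hb with h | h
    · exact h
    · have e1 := contiguousProb_succ p a l b
      refine le_of_mul_le_mul_left ?_ (partialSum_pos h0 (n := a + (l + 1) + b) (by omega))
      linarith
  induction a generalizing b with
  | zero =>
    induction b with
    | zero => exact step 0 0 hb (by simp [partialSum_zero]) (by simp)
    | succ b ih =>
      exact step 0 (b + 1) hb (by simp [partialSum_zero])
        (mul_le_mul_of_nonneg_left (ih (by omega)) (sub_nonneg.2 (hN (by omega))))
  | succ a iha =>
    induction b with
    | zero =>
      exact step (a + 1) 0 hb (mul_le_mul_of_nonneg_left (iha 0 hb) (partialSum_nonneg p _))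
        (by simp)
    | succ b ih =>
      exact step (a + 1) (b + 1) hb
        (mul_le_mul_of_nonneg_left (iha (b + 1) hb) (partialSum_nonneg p _))
        (mul_le_mul_of_nonneg_left (ih (by omega)) (sub_nonneg.2 (hN (by omega))))

/-- The product of the ratios `N_j / N_{j + l + 1}`, the probability that all `a` smaller values occur
before the first of the `l + 1` values following them. -/
noncomputable def ratioProd (p : PMF ℕ) (l a : ℕ) : ℝ :=
  ∏ j ∈ Finset.range a, partialSum p (j + 1) / partialSum p (j + 1 + (l + 1))

lemma ratioProd_zero (l : ℕ) : ratioProd p l 0 = 1 := by simp [ratioProd]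

lemma mul_ratioProd (h0 : 0 < p 0) (l a : ℕ) :
    partialSum p (a + 1) * ratioProd p l a =
      partialSum p (a + 1 + (l + 1)) * ratioProd p l (a + 1) := by
  have := partialSum_pos h0 (n := a + 1 + (l + 1)) (by omega)
  rw [ratioProd, ratioProd, Finset.prod_range_succ]
  field_simp

lemma ratioProd_nonneg (l a : ℕ) : 0 ≤ ratioProd p l a :=
  Finset.prod_nonneg fun _ _ => div_nonneg (partialSum_nonneg p _) (partialSum_nonneg p _)

/-- It suffices that all smaller values precede the block and that the block then comes before the
remaining larger ones. The left side is a subsolution of the recursion: the source term is dropped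
unless `a = 0`. -/
lemma ratioProd_mul_le_contiguousProb (h0 : 0 < p 0) (l a b : ℕ) :
    ratioProd p l a * prodPartialSum p l ≤ contiguousProb p a (l + 1) b := by
  have hN := partialSum_mono p
  have step : ∀ a b, (a = 0 ∨ ratioProd p l (a - 1) * prodPartialSum p l ≤
        contiguousProb p (a - 1) (l + 1) b) →
      (partialSum p (a + (l + 1) + b) - partialSum p (a + (l + 1))) *
        (ratioProd p l a * prodPartialSum p l) ≤
        (partialSum p (a + (l + 1) + b) - partialSum p (a + (l + 1))) *
        contiguousProb p a (l + 1) (b - 1) →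
      ratioProd p l a * prodPartialSum p l ≤ contiguousProb p a (l + 1) b := by
    intro a b h1 h2
    have e1 := contiguousProb_succ p a l b
    refine le_of_mul_le_mul_left ?_ (partialSum_pos h0 (n := a + (l + 1) + b) (by omega))
    rcases a with _ | a
    · have h3 := mul_le_mul_of_nonneg_left (prodPartialSum_le_leadingProb h0 l b)
        (partialSum_nonneg p (0 + (l + 1)))
      rw [partialSum_zero, sub_zero, zero_mul] at e1
      rw [ratioProd_zero] at *
      linarith
    · have h3 := mul_le_mul_of_nonneg_left (h1.resolve_left (by omega))
        (partialSum_nonneg p (a + 1))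
      have h4 := mul_nonneg (sub_nonneg.2 (hN (by omega : a + 1 ≤ a + 1 + (l + 1))))
        (leadingProb_nonneg (p := p) (a + 1) l b)
      rw [Nat.add_sub_cancel] at *
      have h5 := mul_ratioProd h0 l a
      rw [← mul_assoc, h5] at h3
      linarith
  induction a generalizing b with
  | zero =>
    induction b with
    | zero => exact step 0 0 (Or.inl rfl) (by simp)
    | succ b ih =>
      exact step 0 (b + 1) (Or.inl rfl)
        (mul_le_mul_of_nonneg_left ih (sub_nonneg.2 (hN (by omega))))
  | succ a iha =>
    induction b with
    | zero => exact step (a + 1) 0 (Or.inr (iha 0)) (by simp)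
    | succ b ih =>
      exact step (a + 1) (b + 1) (Or.inr (iha (b + 1)))
        (mul_le_mul_of_nonneg_left ih (sub_nonneg.2 (hN (by omega))))

/-- Either all smaller values precede the block, or the block starts with one missing, which costs
the power. No control of the larger values is needed, so this serves the case of a vanishing
product. -/
lemma contiguousProb_le_ratioProd_add (h0 : 0 < p 0) (l a b : ℕ) :
    contiguousProb p a (l + 1) b ≤ ratioProd p l a + (1 - partialSum p 1) ^ l := by
  have hN := partialSum_mono p
  have he : 0 ≤ (1 - partialSum p 1) ^ l := pow_nonneg (sub_nonneg.2 (partialSum_le_one p 1)) l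
  refine contiguousProb_le_of_supersolution h0 l b
    (fun a _ => ratioProd p l a + (1 - partialSum p 1) ^ l) (fun a b _ => ?_) a b le_rfl
  rcases a with _ | a
  · left
    rw [ratioProd_zero]
    linarith [contiguousProb_le_one (p := p) 0 (l + 1) b]
  · right
    have h3 := mul_le_mul_of_nonneg_left (leadingProb_le_pow h0 a.succ_pos l b)
      (sub_nonneg.2 (hN (by omega : a + 1 ≤ a + 1 + (l + 1))))
    have h5 := mul_ratioProd h0 l a
    rw [Nat.add_sub_cancel]
    rw [Nat.succ_eq_add_one] at h3
    linarith

/-- An upper bound for the expected number of larger values that occur before the first of the `l + 1`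
values following the `a` smallest ones. -/
noncomputable def excessBound (p : PMF ℕ) (l a : ℕ) : ℝ :=
  ∑ j ∈ Finset.range (a + 1), (1 - partialSum p (j + (l + 1))) / partialSum p (j + (l + 1))

lemma excessBound_nonneg (l a : ℕ) : 0 ≤ excessBound p l a :=
  Finset.sum_nonneg fun _ _ =>
    div_nonneg (sub_nonneg.2 (partialSum_le_one p _)) (partialSum_nonneg p _)

/-- If more than `M` larger values remain when the block starts, the last factor is at most
`leadingProb p 0 l M`. Otherwise at least `b₀ - M` of them were used up earlier, which Markov's
inequality bounds by the last term. The proof replaces this by a supersolution in which `b₀ - b`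
counts the larger values already used and `excessBound` bounds the expected number still to come. -/
lemma contiguousProb_le (h0 : 0 < p 0) (l a : ℕ) {M b₀ : ℕ} (hM : M < b₀) :
    contiguousProb p a (l + 1) b₀ ≤ ratioProd p l a * leadingProb p 0 l M +
      (1 - partialSum p 1) ^ l + excessBound p l a / ((b₀ : ℝ) - M) := by
  have hN := partialSum_mono p
  have he : 0 ≤ (1 - partialSum p 1) ^ l := pow_nonneg (sub_nonneg.2 (partialSum_le_one p 1)) l
  set e := (1 - partialSum p 1) ^ l
  set K := leadingProb p 0 l M
  have hK : 0 ≤ K := measureReal_nonneg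
  have hδ : (0 : ℝ) < (b₀ : ℝ) - M := sub_pos.2 (by exact_mod_cast hM)
  set δ := (b₀ : ℝ) - M with hδdef
  have main := contiguousProb_le_of_supersolution h0 l b₀
    (fun a b => ratioProd p l a * K + e + ((b₀ : ℝ) - b + excessBound p l a) / δ)
    (fun a b hb => ?_) a b₀ le_rfl
  · simpa using main
  have hbr : (b : ℝ) ≤ b₀ := by exact_mod_cast hb
  rcases le_or_gt b M with hbM | hbM
  · left
    have hbM' : (b : ℝ) ≤ M := by exact_mod_cast hbM
    -- With at most `M` larger values left, the Markov term alone exceeds the trivial bound one.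
    have h1 : 1 ≤ ((b₀ : ℝ) - b + excessBound p l a) / δ := by
      rw [le_div_iff₀ hδ]
      linarith [excessBound_nonneg (p := p) l a]
    linarith [contiguousProb_le_one (p := p) a (l + 1) b,
      mul_nonneg (ratioProd_nonneg (p := p) l a) hK]
  right
  obtain ⟨b, rfl⟩ : ∃ b', b = b' + 1 := ⟨b - 1, by omega⟩
  have hA := partialSum_pos h0 (n := a + (l + 1)) (by omega)
  have hD1 := partialSum_le_one p (a + (l + 1) + (b + 1))
  have hAD : partialSum p (a + (l + 1)) ≤ partialSum p (a + (l + 1) + (b + 1)) := hN (by omega)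
  set D := partialSum p (a + (l + 1) + (b + 1))
  rw [Nat.add_sub_cancel]
  push_cast at *
  rcases a with _ | a
  -- Before the next value below `A`'s range is drawn, the number of samples beyond it is geometric
  -- with mean `(1 - A) / A`, where `A = partialSum p (0 + (l + 1))`; this is the only summand at `a
  -- = 0`.
  · have hH : partialSum p (0 + (l + 1)) * excessBound p l 0 = 1 - partialSum p (0 + (l + 1)) := by
      rw [excessBound, Finset.sum_range_one, mul_div_cancel₀ _ hA.ne']
    rw [ratioProd_zero, partialSum_zero, zero_mul, sub_zero]
    have hg := mul_le_mul_of_nonneg_left (leadingProb_antitone h0 0 l hbM.le) hA.le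
    set A := partialSum p (0 + (l + 1))
    set g := leadingProb p 0 l (b + 1)
    have hdiv : (D - A) ≤ A * ((b₀ : ℝ) - (b + 1) + excessBound p l 0) := by
      nlinarith
    have hx : ((b₀ : ℝ) - b + excessBound p l 0) / δ =
        ((b₀ : ℝ) - (b + 1) + excessBound p l 0) / δ + 1 / δ := by ring
    have hdiv' : (D - A) * (1 / δ) ≤ A * (((b₀ : ℝ) - (b + 1) + excessBound p l 0) / δ) := by
      rw [mul_one_div, mul_div_assoc']
      exact div_le_div_of_nonneg_right hdiv hδ.le
    rw [hx]
    set x := ((b₀ : ℝ) - (b + 1) + excessBound p l 0) / δ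
    nlinarith [mul_nonneg hA.le he]
  · have hH : excessBound p l (a + 1) = excessBound p l a +
        (1 - partialSum p (a + 1 + (l + 1))) / partialSum p (a + 1 + (l + 1)) := by
      rw [excessBound, Finset.sum_range_succ]
      rfl
    have hH0 := excessBound_nonneg (p := p) l a
    rw [Nat.add_sub_cancel]
    have hnA : partialSum p (a + 1) ≤ partialSum p (a + 1 + (l + 1)) := hN (by omega)
    have hg := mul_le_mul_of_nonneg_left (leadingProb_le_pow h0 a.succ_pos l (b + 1))
      (sub_nonneg.2 hnA)
    have h5 := mul_ratioProd h0 l a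
    have hn := partialSum_nonneg p (a + 1)
    set A := partialSum p (a + 1 + (l + 1))
    set n := partialSum p (a + 1)
    rw [Nat.succ_eq_add_one] at hg
    set g := leadingProb p (a + 1) l (b + 1)
    have hh : A * ((1 - A) / A) = 1 - A := mul_div_cancel₀ _ hA.ne'
    have hx : ((b₀ : ℝ) - b + excessBound p l (a + 1)) / δ =
        ((b₀ : ℝ) - (b + 1) + excessBound p l a) / δ + (1 + (1 - A) / A) / δ := by
      rw [hH]
      ring
    have hx' : ((b₀ : ℝ) - (b + 1) + excessBound p l (a + 1)) / δ =
        ((b₀ : ℝ) - (b + 1) + excessBound p l a) / δ + ((1 - A) / A) / δ := by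
      rw [hH]
      ring
    have hx0 : 0 ≤ ((b₀ : ℝ) - (b + 1) + excessBound p l a) / δ :=
      div_nonneg (by linarith) hδ.le
    -- Using up a larger value raises the count by one; the summand `(1 - A) / A` pays for this.
    -- After clearing `A` the inequality is `D ≤ 1`.
    have hdiv : (D - A) * ((1 + (1 - A) / A) / δ) ≤ D * (((1 - A) / A) / δ) := by
      rw [mul_div_assoc', mul_div_assoc']
      refine div_le_div_of_nonneg_right ?_ hδ.le
      nlinarith
    rw [hx, hx']
    set x := ((b₀ : ℝ) - (b + 1) + excessBound p l a) / δ
    have hnx := mul_le_mul_of_nonneg_right hnA hx0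
    have h5' : n * (ratioProd p l a * K) = A * (ratioProd p l (a + 1) * K) := by
      rw [← mul_assoc, h5, mul_assoc]
    linarith

/-! ### Limits of the bounds -/

/-- The quotient telescopes, leaving `l + 1` factors in numerator and denominator however large `a`
is; those in the denominator tend to one as `a` grows. -/
lemma ratioProd_eq_div (h0 : 0 < p 0) (l a : ℕ) :
    ratioProd p l a =
      prodPartialSum p (l + 1) / ∏ i ∈ Finset.range (l + 1), partialSum p (a + i + 1) := by
  have h1 : prodPartialSum p (a + (l + 1)) =
      prodPartialSum p a * ∏ i ∈ Finset.range (l + 1), partialSum p (a + i + 1) :=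
    Finset.prod_range_add _ _ _
  have h2 : prodPartialSum p (a + (l + 1)) = prodPartialSum p (l + 1) *
      ∏ j ∈ Finset.range a, partialSum p (j + 1 + (l + 1)) := by
    rw [add_comm a, prodPartialSum, Finset.prod_range_add]
    congr 1
    exact Finset.prod_congr rfl fun j _ => by rw [add_comm (l + 1) j, add_right_comm]
  have h3 : 0 < ∏ i ∈ Finset.range (l + 1), partialSum p (a + i + 1) :=
    Finset.prod_pos fun i _ => partialSum_pos h0 (by omega)
  have h4 : 0 < ∏ j ∈ Finset.range a, partialSum p (j + 1 + (l + 1)) :=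
    Finset.prod_pos fun i _ => partialSum_pos h0 (by omega)
  rw [ratioProd, Finset.prod_div_distrib, div_eq_div_iff h4.ne' h3.ne', ← h2, h1]
  rfl

lemma tendsto_ratioProd_atTop (h0 : 0 < p 0) (l : ℕ) :
    Tendsto (ratioProd p l) atTop (𝓝 (prodPartialSum p (l + 1))) := by
  have h : Tendsto (fun a => ∏ i ∈ Finset.range (l + 1), partialSum p (a + i + 1)) atTop
      (𝓝 (∏ i ∈ Finset.range (l + 1), 1)) :=
    tendsto_finsetProd _ fun i _ => (tendsto_partialSum p).comp (tendsto_add_atTop_nat (i + 1))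
  rw [Finset.prod_const_one] at h
  have h2 := (tendsto_const_nhds (x := prodPartialSum p (l + 1))).div h one_ne_zero
  rw [div_one] at h2
  exact h2.congr fun a => (ratioProd_eq_div h0 l a).symm

lemma tendsto_ratioProd_left (a : ℕ) :
    Tendsto (fun l => ratioProd p l a) atTop (𝓝 (prodPartialSum p a)) := by
  refine tendsto_finsetProd _ fun j _ => ?_
  have h1 : Tendsto (fun l => partialSum p (j + 1 + (l + 1))) atTop (𝓝 1) :=
    (tendsto_partialSum p).comp <| tendsto_atTop_mono (fun l => by simp; omega) tendsto_id
  have h2 := (tendsto_const_nhds (x := partialSum p (j + 1))).div h1 one_ne_zero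
  rwa [div_one] at h2

lemma tendsto_one_sub_partialSum_pow (h0 : 0 < p 0) :
    Tendsto (fun l : ℕ => (1 - partialSum p 1) ^ l) atTop (𝓝 0) :=
  tendsto_pow_atTop_nhds_zero_of_lt_one (sub_nonneg.2 (partialSum_le_one p 1))
    (by linarith [partialSum_pos h0 one_pos])

/-- Along sequences of numbers of smaller and of larger values, of which the latter tends to infinity,
a bound on the expected number of larger values gives the expected upper bound. -/
lemma limsup_contiguousProb_le {ι : Type*} {F : Filter ι} [F.NeBot] (h0 : 0 < p 0) (l : ℕ)
    {a b : ι → ℕ} (hb : Tendsto b F atTop) {R B : ℝ}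
    (hR : Tendsto (fun n => ratioProd p l (a n)) F (𝓝 R))
    (hB : ∀ n, excessBound p l (a n) ≤ B) :
    limsup (fun n => contiguousProb p (a n) (l + 1) (b n)) F ≤
      R * prodPartialSum p l + (1 - partialSum p 1) ^ l := by
  -- For fixed `M` the Markov term vanishes along the filter; afterwards `M` tends to infinity.
  have hM : ∀ M, limsup (fun n => contiguousProb p (a n) (l + 1) (b n)) F ≤
      R * leadingProb p 0 l M + (1 - partialSum p 1) ^ l := by
    intro M
    have hlim : Tendsto (fun n => ratioProd p l (a n) * leadingProb p 0 l M +
        (1 - partialSum p 1) ^ l + B / ((b n : ℝ) - M)) F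
        (𝓝 (R * leadingProb p 0 l M + (1 - partialSum p 1) ^ l + 0)) := by
      refine ((hR.mul_const _).add_const _).add ?_
      refine Tendsto.const_div_atTop ?_ B
      exact tendsto_atTop_add_const_right _ _ (tendsto_natCast_atTop_atTop.comp hb)
    rw [add_zero] at hlim
    rw [← hlim.limsup_eq]
    refine limsup_le_limsup ?_ ?_ hlim.isBoundedUnder_le
    · filter_upwards [hb.eventually_gt_atTop M] with n hn
      refine (contiguousProb_le h0 l (a n) hn).trans ?_
      have : (0 : ℝ) ≤ (b n : ℝ) - M := sub_nonneg.2 (by exact_mod_cast hn.le)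
      exact add_le_add_right (div_le_div_of_nonneg_right (hB n) this) _
    · exact isCoboundedUnder_le_of_le F fun n => contiguousProb_nonneg _ _ _
  exact ge_of_tendsto' (((tendsto_leadingProb_zero h0 l).const_mul R).add_const _) hM

lemma tendsto_pShiftedFin_cluster (h0 : 0 < p 0) (a l : ℕ) :
    Tendsto (fun n => (pShiftedFin p n).real (cluster n (l + 1) (a + 1))) atTop
      (𝓝 (⨅ b, contiguousProb p a (l + 1) b)) := by
  have h : Tendsto (contiguousProb p a (l + 1)) atTop (𝓝 (⨅ b, contiguousProb p a (l + 1) b)) :=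
    tendsto_atTop_ciInf (contiguousProb_antitone h0 a l)
      ⟨0, by rintro _ ⟨b, rfl⟩; exact contiguousProb_nonneg _ _ _⟩
  rw [← tendsto_add_atTop_iff_nat (a + (l + 1))]
  refine h.congr fun b => ?_
  rw [add_comm b, pShiftedFin_real_cluster h0 a b l.succ_pos]

/-- For fixed `a` the excess is a constant independent of `b`, so no summability of the tails is
needed. -/
lemma tendsto_iInf_contiguousProb (h0 : 0 < p 0) (a : ℕ) :
    Tendsto (fun l => ⨅ b, contiguousProb p a (l + 1) b) atTop
      (𝓝 (prodPartialSum p a * ∏' j : ℕ, partialSum p (j + 1))) := by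
  have hlow := (tendsto_ratioProd_left (p := p) a).mul (tendsto_prodPartialSum p)
  have hup := hlow.add (tendsto_one_sub_partialSum_pow h0)
  rw [add_zero] at hup
  refine tendsto_of_tendsto_of_tendsto_of_le_of_le hlow hup (fun l => ?_) fun l => ?_
  · exact le_ciInf fun b => ratioProd_mul_le_contiguousProb h0 l a b
  · have h : Tendsto (contiguousProb p a (l + 1)) atTop
        (𝓝 (⨅ b, contiguousProb p a (l + 1) b)) :=
      tendsto_atTop_ciInf (contiguousProb_antitone h0 a l)
        ⟨0, by rintro _ ⟨b, rfl⟩; exact contiguousProb_nonneg _ _ _⟩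
    dsimp only
    rw [← h.limsup_eq]
    exact limsup_contiguousProb_le h0 l tendsto_id tendsto_const_nhds fun _ => le_rfl

/-- The excess is bounded uniformly if the tails of the distribution are summable. -/
lemma exists_excessBound_le (h0 : 0 < p 0) (hs : Summable fun j => 1 - partialSum p (j + 1))
    (l : ℕ) : ∃ B, ∀ a, excessBound p l a ≤ B := by
  have hnn : ∀ j, 0 ≤ 1 - partialSum p j := fun j => sub_nonneg.2 (partialSum_le_one p j)
  have hs' : Summable fun j => (1 - partialSum p (j + (l + 1))) / partialSum p 1 :=
    ((summable_nat_add_iff (f := fun j => 1 - partialSum p (j + 1)) l).2 hs).div_const _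
      |>.congr fun j => by rw [add_assoc]
  refine ⟨∑' j, (1 - partialSum p (j + (l + 1))) / partialSum p 1, fun a => ?_⟩
  refine le_trans (Finset.sum_le_sum fun j _ => ?_) (hs'.sum_le_tsum (Finset.range (a + 1))
    fun j _ => div_nonneg (hnn _) (partialSum_nonneg p 1))
  exact div_le_div_of_nonneg_left (hnn _) (partialSum_pos h0 one_pos)
    (partialSum_mono p (by omega))

lemma liminf_limsup_contiguousProb (h0 : 0 < p 0) (φ : ℕ → ℕ → ℝ) (a : ℕ → ℕ) (b : ℕ → ℕ → ℕ)
    (ha : Tendsto a atTop atTop) (hb : ∀ l, Tendsto (b l) atTop atTop)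
    (hφ : ∀ l, φ (l + 1) =ᶠ[atTop] fun n => contiguousProb p (a n) (l + 1) (b l n)) :
    Tendsto (fun l => liminf (φ l) atTop) atTop (𝓝 ((∏' j : ℕ, partialSum p (j + 1)) ^ 2)) ∧
    Tendsto (fun l => limsup (φ l) atTop) atTop (𝓝 ((∏' j : ℕ, partialSum p (j + 1)) ^ 2)) := by
  have hR : ∀ l, Tendsto (fun n => ratioProd p l (a n)) atTop (𝓝 (prodPartialSum p (l + 1))) :=
    fun l => (tendsto_ratioProd_atTop h0 l).comp ha
  have hbdd : ∀ l, IsBoundedUnder (· ≤ ·) atTop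
      fun n => contiguousProb p (a n) (l + 1) (b l n) := fun l =>
    isBoundedUnder_of ⟨1, fun n => contiguousProb_le_one _ _ _⟩
  have hbdd' : ∀ l, IsBoundedUnder (· ≥ ·) atTop
      fun n => contiguousProb p (a n) (l + 1) (b l n) := fun l =>
    isBoundedUnder_of ⟨0, fun n => contiguousProb_nonneg _ _ _⟩
  have hlow : ∀ l, prodPartialSum p (l + 1) * prodPartialSum p l ≤ liminf (φ (l + 1)) atTop := by
    intro l
    have hlim := (hR l).mul_const (prodPartialSum p l)
    rw [liminf_congr (hφ l), ← hlim.liminf_eq]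
    exact liminf_le_liminf (.of_forall fun n => ratioProd_mul_le_contiguousProb h0 l _ _)
      hlim.isBoundedUnder_ge (hbdd l).isCoboundedUnder_ge
  have hmid : ∀ l, liminf (φ (l + 1)) atTop ≤ limsup (φ (l + 1)) atTop := by
    intro l
    rw [liminf_congr (hφ l), limsup_congr (hφ l)]
    exact liminf_le_limsup (hbdd l) (hbdd' l)
  have hT := tendsto_prodPartialSum p
  have hT' := (tendsto_add_atTop_iff_nat 1).2 hT
  have he := tendsto_one_sub_partialSum_pow h0
  obtain ⟨U, hUlim, hU⟩ : ∃ U : ℕ → ℝ,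
      Tendsto U atTop (𝓝 ((∏' j : ℕ, partialSum p (j + 1)) ^ 2)) ∧
      ∀ l, limsup (φ (l + 1)) atTop ≤ U l := by
    -- As `a` varies, the Markov term needs a uniform bound on the excess, which summable tails
    -- provide when the product is positive. When it is zero, the crude bound already tends to zero.
    rcases (tprod_partialSum_nonneg p).eq_or_lt with h | h
    · refine ⟨fun l => prodPartialSum p (l + 1) + (1 - partialSum p 1) ^ l, ?_, fun l => ?_⟩
      · have := hT'.add he
        rw [← h] at this ⊢
        simpa using this
      · have hlim := (hR l).add_const ((1 - partialSum p 1) ^ l)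
        dsimp only
        rw [limsup_congr (hφ l), ← hlim.limsup_eq]
        exact limsup_le_limsup (.of_forall fun n => contiguousProb_le_ratioProd_add h0 l _ _)
          (hbdd' l).isCoboundedUnder_le hlim.isBoundedUnder_le
    · refine ⟨fun l => prodPartialSum p (l + 1) * prodPartialSum p l +
        (1 - partialSum p 1) ^ l, ?_, fun l => ?_⟩
      · have := (hT'.mul hT).add he
        rwa [add_zero, ← sq] at this
      · obtain ⟨B, hB⟩ := exists_excessBound_le h0
          ((tprod_partialSum_pos_iff_summable h0).1 h) l
        rw [limsup_congr (hφ l)]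
        exact limsup_contiguousProb_le h0 l (hb l) (hR l) fun n => hB _
  have hL := hT'.mul hT
  rw [← sq] at hL
  exact ⟨(tendsto_add_atTop_iff_nat 1).1 <| tendsto_of_tendsto_of_tendsto_of_le_of_le hL hUlim
      hlow fun l => (hmid l).trans (hU l),
    (tendsto_add_atTop_iff_nat 1).1 <| tendsto_of_tendsto_of_tendsto_of_le_of_le hL hUlim
      (fun l => (hlow l).trans (hmid l)) hU⟩

end PShift

/-! ### Assembly of the theorem -/

theorem theorem3 (p : PMF ℕ) (hpos : ∀ i : ℕ, 0 < p i) (hmono : ∀ i j : ℕ, i ≤ j → p j ≤ p i) :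
    -- the infinite product of the partial sums converges
    Multipliable (fun j : ℕ => partialSum p (j + 1)) ∧
    -- fixed k
    (∀ k : ℕ, 1 ≤ k → ∃ (L : ℕ → ℝ) (c : ℝ),
      (∀ l : ℕ, Tendsto (fun n : ℕ => (pShiftedFin p n).real (cluster n l k)) atTop (𝓝 (L l))) ∧
      Tendsto L atTop (𝓝 c) ∧
      c = (∏ j ∈ Finset.Ico 1 k, partialSum p j) * ∏' j : ℕ, partialSum p (j + 1) ∧
      (0 < c ↔ ∑' i : ℕ, ((i + 1 : ℕ) : ℝ≥0∞) * p i < ∞)) ∧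
    -- k depending on n
    (∀ k : ℕ → ℕ, Tendsto (fun n : ℕ => min (k n : ℤ) ((n : ℤ) - (k n : ℤ))) atTop atTop →
      ∃ c : ℝ,
        Tendsto (fun l : ℕ =>
          liminf (fun n : ℕ => (pShiftedFin p n).real (cluster n l (k n))) atTop) atTop (𝓝 c) ∧
        Tendsto (fun l : ℕ =>
          limsup (fun n : ℕ => (pShiftedFin p n).real (cluster n l (k n))) atTop) atTop (𝓝 c) ∧
        c = (∏' j : ℕ, partialSum p (j + 1)) ^ 2 ∧
        (0 < c ↔ ∑' i : ℕ, ((i + 1 : ℕ) : ℝ≥0∞) * p i < ∞)) ∧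
    -- finite mean and positive recurrence
    (∑' i : ℕ, ((i + 1 : ℕ) : ℝ≥0∞) * p i < ∞ ↔ PositiveRecurrent p) := by
  have h0 := hpos 0
  have hiff := tprod_partialSum_pos_iff h0
  refine ⟨multipliable_partialSum p, fun k hk => ?_, fun k hk => ?_, ?_⟩
  · obtain ⟨a, rfl⟩ : ∃ a, k = a + 1 := ⟨k - 1, by omega⟩
    -- An empty block is always contiguous once `n ≥ a`, so its limit is one; the estimates treat
    -- only blocks of positive length.
    refine ⟨fun l => if l = 0 then 1 else ⨅ b, contiguousProb p a l b,
      prodPartialSum p a * ∏' j : ℕ, partialSum p (j + 1), fun l => ?_, ?_, ?_, ?_⟩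
    · rcases l with _ | l
      · refine tendsto_const_nhds.congr' ?_
        filter_upwards [eventually_ge_atTop a] with n hn
        rw [if_pos rfl, pShiftedFin_real_cluster_zero p (by omega) (by omega)]
      · dsimp only
        rw [if_neg l.succ_ne_zero]
        exact tendsto_pShiftedFin_cluster h0 a l
    · rw [← tendsto_add_atTop_iff_nat 1]
      exact (tendsto_iInf_contiguousProb h0 a).congr fun l => (if_neg l.succ_ne_zero).symm
    · rw [prodPartialSum, Finset.prod_Ico_eq_prod_range, Nat.add_sub_cancel]
      simp only [add_comm 1]
    · rw [mul_pos_iff_of_pos_left (prodPartialSum_pos h0 a), hiff]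
  · have hk1 : Tendsto (fun n => (k n : ℤ)) atTop atTop :=
      tendsto_atTop_mono (fun n => min_le_left _ _) hk
    have hk2 : Tendsto (fun n : ℕ => (n : ℤ) - k n) atTop atTop :=
      tendsto_atTop_mono (fun n => min_le_right _ _) hk
    have ha : Tendsto (fun n => k n - 1) atTop atTop := by
      refine tendsto_atTop.2 fun m => ?_
      filter_upwards [hk1.eventually_ge_atTop ((m : ℤ) + 1)] with n hn
      omega
    -- The number of values above a block of length `l + 1` starting at `k n`.
    have hb : ∀ l : ℕ, Tendsto (fun n => n - (k n - 1) - (l + 1)) atTop atTop := by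
      refine fun l => tendsto_atTop.2 fun m => ?_
      filter_upwards [hk2.eventually_ge_atTop ((m : ℤ) + l + 1)] with n hn
      omega
    obtain ⟨h1, h2⟩ := liminf_limsup_contiguousProb h0
      (fun l n => (pShiftedFin p n).real (cluster n l (k n))) (fun n => k n - 1)
      (fun l n => n - (k n - 1) - (l + 1)) ha hb fun l => by
        filter_upwards [hk1.eventually_ge_atTop 1, hk2.eventually_ge_atTop ((l : ℤ) + 1)]
          with n hn1 hn2
        have := pShiftedFin_real_cluster h0 (k n - 1) (n - (k n - 1) - (l + 1)) l.succ_pos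
        rwa [show k n - 1 + l.succ + (n - (k n - 1) - (l + 1)) = n by omega,
          show k n - 1 + 1 = k n by omega] at this
    refine ⟨_, h1, h2, rfl, ?_⟩
    rw [← hiff]
    exact ⟨fun h => (tprod_partialSum_nonneg p).lt_of_ne' fun h' => by simp [h'] at h,
      fun h => pow_pos h 2⟩
  · rw [positiveRecurrent_iff_tprod_pos h0, hiff]
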